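/- Let $p$ be a prime. For a commutative ring $R$, let $W(R)$ be the ring of $p$-typical Witt vectors of $R$, let $W_{p^n}(R)$ be its truncation to the first $n+1$ components, and let $F:W(R)\to W(R)$ and $F:W_{p^{n}}(R)\to W_{p^{n-1}}(R)$ be the Witt vector Frobenius homomorphisms. For $r\in R$ let $[r]=(r,0,0,\dots)\in W(R)$ be the Teichmüller element. Define ideals of $R$ by $I_0=R$, $I_i=\{r\in R: r^p\in pI_{i-1}\}$ for $i\ge 1$, and put $I_\infty=\bigcap_i I_i$. Let $R$ be one of the following rings: the ring $\mathbb{Z}[\mu_{p^\infty}]$ generated by all roots of unity of $p$-power order in $\mathbb{C}$; the ring $\mathbb{Z}_p[\mu_{p^\infty}]$ generated over $\mathbb{Z}_p$ by all roots of unity of $p$-power order in an algebraic closure of $\mathbb{Q}_p$; or the $p$-adic completion of $\mathbb{Z}_p[\mu_{p^\infty}]$. Then: 1. $F:W_{p^n}(R)\to W_{p^{n-1}}(R)$ is surjective for every $n\ge 2$. 2. The image of $F:W(R)\to W(R)$ does not contain all Teichmüller elements $[r]$, $r\in R$. 3. The $p$-th power map on $R/pI_\infty$ is not surjective. More precisely: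 - if $p>2$, then there is no $x\in R$ with $x^p\equiv 1-p \pmod{pI_\infty}$; - if $p=2$, then for every primitive $4$th root of unity $i\in R$ and every primitive $8$th root of unity $\zeta\in R$ there is no $x\in R$ with $x^2\equiv i+2\zeta \pmod{2I_\infty}$. -/

import Mathlib

noncomputable section

/-! ### Frobenius on Witt vectors of finite length -/

section TruncatedFrobenius

variable (p : ℕ) [hp : Fact p.Prime] (n : ℕ) (R : Type*) [CommRing R]

/-- The `i`-th component of `F x` involves only the components `x_0, …, x_{i+1}` of `x`. -/
theorem frobeniusPoly_vars_subset (i : ℕ) :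
    (WittVector.frobeniusPoly p i).vars ⊆ Finset.range (i + 2) := by
  classical
  have h : (WittVector.frobeniusPolyRat p i).vars ⊆ Finset.range (i + 2) := by
    unfold WittVector.frobeniusPolyRat
    refine (MvPolynomial.vars_bind₁ _ _).trans ?_
    intro k hk
    rw [Finset.mem_biUnion] at hk
    obtain ⟨j, hj, hkj⟩ := hk
    have h1 := xInTermsOfW_vars_subset p i hj
    have h2 := wittPolynomial_vars_subset p ℚ (j + 1) hkj
    rw [Finset.mem_range] at h1 h2 ⊢
    omega
  rw [← WittVector.map_frobeniusPoly p i,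
    MvPolynomial.vars_map_of_injective _ (Int.cast_injective)] at h
  exact h

theorem truncate_frobenius_of_mem_ker (x : WittVector p R)
    (hx : WittVector.truncate (n + 1) x = 0) :
    WittVector.truncate n (WittVector.frobenius x) = 0 := by
  have hx' := (WittVector.mem_ker_truncate (n + 1) x).mp hx
  refine (WittVector.mem_ker_truncate n _).mpr fun i hi => ?_
  have h0 : (WittVector.frobenius (0 : WittVector p R)).coeff i = 0 := by simp
  rw [WittVector.coeff_frobenius] at h0 ⊢
  rw [← h0]
  refine MvPolynomial.eval₂Hom_congr' rfl (fun j hj _ => ?_) rfl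
  have := Finset.mem_range.mp (frobeniusPoly_vars_subset p i hj)
  rw [hx' j (by omega), WittVector.zero_coeff]

/-- The Frobenius homomorphism from Witt vectors with `n + 1` components to Witt vectors with
`n` components. It is the map induced by the Frobenius of `W(R)`; see
`truncatedFrobenius_truncate`. -/
def truncatedFrobenius :
    TruncatedWittVector p (n + 1) R →+* TruncatedWittVector p n R :=
  (WittVector.truncate (p := p) (R := R) (n + 1)).liftOfRightInverse
    TruncatedWittVector.out (fun x => TruncatedWittVector.truncateFun_out x)
    ⟨(WittVector.truncate n).comp WittVector.frobenius,
      fun x hx => truncate_frobenius_of_mem_ker p n R x hx⟩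

theorem truncatedFrobenius_truncate (x : WittVector p R) :
    truncatedFrobenius p n R (WittVector.truncate (n + 1) x) =
      WittVector.truncate n (WittVector.frobenius x) :=
  RingHom.liftOfRightInverse_comp_apply _ _ _ _ x

end TruncatedFrobenius

/-! ### The ideals `I_i` and `I_∞` -/

section Ideals

variable (p : ℕ) (R : Type*) [CommRing R]

/-- The sets `I_0 = R`, `I_{i+1} = {r | r ^ p ∈ p I_i}`. -/
def ISet : ℕ → Set R
  | 0 => Set.univ
  | i + 1 => {r | ∃ s ∈ ISet i, r ^ p = p * s}

theorem ISet_succ_subset (i : ℕ) : ISet p R (i + 1) ⊆ ISet p R i := by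
  induction i with
  | zero => exact fun _ _ => trivial
  | succ i ih =>
    rintro r ⟨s, hs, h⟩
    exact ⟨s, ih hs, h⟩

theorem ISet_smul (i : ℕ) (c : R) {x : R} (hx : x ∈ ISet p R i) :
    c * x ∈ ISet p R i := by
  induction i generalizing c x with
  | zero => trivial
  | succ i ih =>
    obtain ⟨s, hs, h⟩ := hx
    exact ⟨c ^ p * s, ih _ hs, by rw [mul_pow, h]; ring⟩

theorem ISet_zero_mem (hp : p.Prime) (i : ℕ) : (0 : R) ∈ ISet p R i := by
  induction i with
  | zero => trivial
  | succ i ih => exact ⟨0, ih, by simp [hp.ne_zero]⟩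

theorem ISet_add (hp : p.Prime) (i : ℕ) {x y : R} (hx : x ∈ ISet p R i) (hy : y ∈ ISet p R i) :
    x + y ∈ ISet p R i := by
  induction i generalizing x y with
  | zero => trivial
  | succ i ih =>
    have hx0 := ISet_succ_subset p R i hx
    obtain ⟨s, hs, h⟩ := hx
    obtain ⟨t, ht, h'⟩ := hy
    obtain ⟨r, hr⟩ := exists_add_pow_prime_eq hp x y
    refine ⟨s + t + (y * r) * x, ih (ih hs ht) (ISet_smul p R i _ hx0), ?_⟩
    rw [hr, h, h']
    ring

variable [hp : Fact p.Prime]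

/-- The ideal `I_i` of `R`. -/
def IIdeal (i : ℕ) : Ideal R where
  carrier := ISet p R i
  add_mem' := ISet_add p R hp.out i
  zero_mem' := ISet_zero_mem p R hp.out i
  smul_mem' c _ hx := ISet_smul p R i c hx

/-- The ideal `I_∞`, the intersection of all `I_i`. -/
def IInfty : Ideal R := ⨅ i : ℕ, IIdeal p R i

/-- The ideal `p I_∞`. -/
def pIInfty : Ideal R := Ideal.span {(p : R)} * IInfty p R

end Ideals

/-! ### Conditions on a ring -/

section Conditions

variable (p : ℕ) [hp : Fact p.Prime] (R : Type*) [CommRing R]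

/-- `F : W_{p^n}(R) → W_{p^{n-1}}(R)` is surjective for all `n ≥ 2`. Elements of `W_{p^n}(R)` have
`n + 1` components. -/
def FrobeniusSurjectiveFiniteLevels : Prop :=
  ∀ n : ℕ, 2 ≤ n → Function.Surjective (truncatedFrobenius p n R)

/-- The image of `F : W(R) → W(R)` contains all Teichmüller elements. -/
def TeichmullerInFrobeniusImage : Prop :=
  ∀ r : R, ∃ x : WittVector p R, WittVector.frobenius x = WittVector.teichmuller p r

/-- The `p`-th power map on `R / p I_∞` is surjective. -/
def PthPowerSurjectiveModPIInfty : Prop :=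
  Function.Surjective (fun x : R ⧸ pIInfty p R => x ^ p)

end Conditions

/-- For an `A`-algebra `K` which is a field, the subalgebra `A[μ_{p^∞}]` of `K` generated by all
roots of unity of `p`-power order in `K`. -/
def adjoinMuPInfty (p : ℕ) (A K : Type*) [CommRing A] [Field K] [Algebra A K] : Subalgebra A K :=
  Algebra.adjoin A {ζ : K | ∃ n : ℕ, ζ ^ p ^ n = 1}

/-- The ring `ℤ[μ_{p^∞}]`. -/
abbrev ZMuPInfty (p : ℕ) : Type := adjoinMuPInfty p ℤ ℂ

/-- The ring `ℤ_p[μ_{p^∞}]`. -/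
abbrev ZpMuPInfty (p : ℕ) [Fact p.Prime] : Type :=
  adjoinMuPInfty p ℤ_[p] (AlgebraicClosure ℚ_[p])

/-- The `p`-adic completion of `ℤ_p[μ_{p^∞}]`. -/
abbrev ZpMuPInftyCompletion (p : ℕ) [Fact p.Prime] : Type :=
  AdicCompletion (Ideal.span {(p : ZpMuPInfty p)}) (ZpMuPInfty p)

end

/-! ### Surjectivity of Frobenius at finite levels -/

section FiniteLevels

open WittVector Finset

variable {p : ℕ} [hp : Fact p.Prime] {R : Type*} [CommRing R]

/-! Finite levels: `V^n 1` is the sum of the `[ζ^i]` over the `p^n`-th roots of unity, hence is `F`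
of a similar sum (`exists_frobenius_eq_iterate_verschiebung_one`). Together with surjectivity of the
`p`-th power map on `R/p`, this corrects components one at a time (`truncate_frobenius_surjective`).

Teichmüller elements: if `F x = [r]`, all components of `x` after the zeroth lie in `I_∞`
(`coeff_mem_IIdeal`), and `r = x_0^p + p x_1`. So `r` is a `p`-th power modulo `p I_∞`, and only the
explicit congruences remain.

Congruences: in the integers of the algebraic closure of `ℚ_p`, elements of `I_∞` satisfy `|s|^(p-1)
≤ |p|`. A solution is a polynomial in `λ = ζ - 1` for some `ζ` of large `p`-power order. As `p` is a
unit times a power of `λ`, divisibility by powers of `λ` dividing `p` passes to `𝔽_p[X]`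
(`X_pow_dvd_map_of_pow_dvd_aeval`). For odd `p` the outcome is `k^p - X^((p-1)p^n) k ≡ 1` modulo
`X^(p^(n+1))`, which a coefficient chase refutes (`not_X_pow_dvd_pow_sub`). For `p = 2`,
multiplication by a root of unity first reduces to `1 + 2η`, and `not_X_pow_dvd_of_two` ends the
argument.

The other rings: `ℤ[μ_{p^∞}]` maps to `ℤ_p[μ_{p^∞}]` and `I_∞` is functorial; a solution in the
completion is approximated modulo `p^2` (`exists_pow_sub_mem_of_map`). -/

theorem exists_eq_pow_prime_pow_add (hF : ∀ r : R, ∃ s t, r = s ^ p + p * t) (k : ℕ) (r : R) :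
    ∃ s t, r = s ^ p ^ k + p * t := by
  induction k generalizing r with
  | zero => exact ⟨r, 0, by simp⟩
  | succ k ih =>
    obtain ⟨s, t, rfl⟩ := ih r
    obtain ⟨a, b, rfl⟩ := hF s
    obtain ⟨c, hc⟩ := exists_add_pow_prime_pow_eq hp.out (a ^ p) (p * b) k
    refine ⟨a, a ^ p * (p * b) * c + p ^ (p ^ k - 1) * b ^ p ^ k + t, ?_⟩
    have h1 : (p : R) ^ p ^ k = p * p ^ (p ^ k - 1) := by
      rw [← pow_succ', Nat.sub_add_cancel (Nat.pos_of_ne_zero (pow_ne_zero _ hp.out.ne_zero))]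
    rw [hc, mul_pow, h1, ← pow_mul, ← pow_succ']
    ring

theorem map_aeval_int {S : Type*} [CommRing S] (f : R →+* S) (x : ℕ → R) (P : MvPolynomial ℕ ℤ) :
    f (MvPolynomial.aeval x P) = MvPolynomial.aeval (fun i => f (x i)) P :=
  DFunLike.congr_fun (MvPolynomial.comp_aeval (R := ℤ) x f.toIntAlgHom) P

theorem map_frobenius_eq {S : Type*} [CommRing S] (f : R →+* S) (x : WittVector p R) :
    WittVector.map f (frobenius x) = frobenius (WittVector.map f x) := by
  ext n
  rw [map_coeff, coeff_frobenius, coeff_frobenius, map_aeval_int]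
  rfl

theorem ghostMap_injective_of_charZero [IsDomain R] [CharZero R] :
    Function.Injective (ghostMap : WittVector p R → ℕ → R) := by
  let f := algebraMap R (FractionRing R)
  have hf : Function.Injective f := IsFractionRing.injective R (FractionRing R)
  have : CharZero (FractionRing R) := charZero_of_injective_algebraMap hf
  let _ : Invertible (p : FractionRing R) :=
    invertibleOfNonzero (Nat.cast_ne_zero.mpr hp.out.ne_zero)
  intro x y hxy
  apply WittVector.map_injective f hf
  apply (ghostMap.bijective_of_invertible p (FractionRing R)).1
  ext n
  have := congrArg f (congrFun hxy n)
  simp only [ghostMap_apply, ghostComponent_apply, map_aeval_int] at this ⊢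
  exact this

/-- Ghost components determine Witt vectors over `ℤ[X]`, and there both sides agree; specialising
`X` to `s` reaches every ring. -/
theorem frobenius_teichmuller (s : R) :
    frobenius (teichmuller p s) = teichmuller p (s ^ p) := by
  have h : frobenius (teichmuller p (Polynomial.X : Polynomial ℤ)) =
      teichmuller p (Polynomial.X ^ p) := by
    apply ghostMap_injective_of_charZero
    ext1 n
    simp only [ghostMap_apply, ghostComponent_frobenius, ghostComponent_teichmuller, ← pow_mul,
      pow_succ']
  have h2 := congrArg (WittVector.map (Polynomial.eval₂RingHom (Int.castRingHom R) s)) h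
  rw [map_teichmuller, map_frobenius_eq, map_teichmuller] at h2
  simpa using h2

theorem frobenius_iterate_teichmuller (s : R) (n : ℕ) :
    frobenius^[n] (teichmuller p s) = teichmuller p (s ^ p ^ n) := by
  induction n with
  | zero => simp
  | succ n ih => rw [Function.iterate_succ_apply', ih, frobenius_teichmuller, ← pow_mul, pow_succ]

theorem iterate_verschiebung_sub (x y : WittVector p R) (n : ℕ) :
    verschiebung^[n] (x - y) = verschiebung^[n] x - verschiebung^[n] y := by
  induction n with
  | zero => rfl
  | succ n ih => simp only [Function.iterate_succ_apply', ih, map_sub]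

theorem iterate_verschiebung_add (x y : WittVector p R) (n : ℕ) :
    verschiebung^[n] (x + y) = verschiebung^[n] x + verschiebung^[n] y := by
  induction n with
  | zero => rfl
  | succ n ih => simp only [Function.iterate_succ_apply', ih, map_add]

theorem ghostComponent_iterate_verschiebung_one (n j : ℕ) :
    ghostComponent j (verschiebung^[n] (1 : WittVector p R)) =
      if j < n then 0 else (p : R) ^ n := by
  induction n generalizing j with
  | zero => simp
  | succ n ih =>
    rw [Function.iterate_succ_apply']
    cases j with
    | zero => simp [ghostComponent_zero_verschiebung]
    | succ j =>
      rw [ghostComponent_verschiebung, ih]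
      simp only [Nat.add_lt_add_iff_right]
      split_ifs <;> ring

/-- `V ^ n 1` is the sum of the Teichmüller representatives of the `p ^ n`-th roots of unity. -/
theorem sum_teichmuller_pow [IsDomain R] [CharZero R] {ζ : R} {n : ℕ}
    (hζ : IsPrimitiveRoot ζ (p ^ n)) :
    ∑ i ∈ range (p ^ n), teichmuller p (ζ ^ i) = verschiebung^[n] 1 := by
  apply ghostMap_injective_of_charZero
  ext1 j
  rw [ghostMap_apply, ghostMap_apply, ghostComponent_iterate_verschiebung_one, map_sum]
  simp_rw [ghostComponent_teichmuller, ← pow_mul, mul_comm _ (p ^ j), pow_mul]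
  -- A geometric sum of a nontrivial root of unity vanishes; for `j ≥ n` every term is `1`.
  split_ifs with h
  · have h1 : ζ ^ p ^ j ≠ 1 := by
      intro h1
      have := (Nat.pow_dvd_pow_iff_le_right hp.out.one_lt).mp (hζ.dvd_of_pow_eq_one _ h1)
      omega
    have h2 : (ζ ^ p ^ j) ^ p ^ n = 1 := by
      rw [← pow_mul, mul_comm, pow_mul, hζ.pow_eq_one, one_pow]
    have h3 := mul_geom_sum (ζ ^ p ^ j) (p ^ n)
    rw [h2, sub_self] at h3
    exact (mul_eq_zero.mp h3).resolve_left (sub_ne_zero.mpr h1)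
  · have h1 : ζ ^ p ^ j = 1 := by
      obtain ⟨c, hc⟩ := pow_dvd_pow p (not_lt.mp h)
      rw [hc, pow_mul, hζ.pow_eq_one, one_pow]
    simp [h1]

theorem exists_frobenius_eq_iterate_verschiebung_one [IsDomain R] [CharZero R]
    (hζ : ∀ n, ∃ ζ : R, IsPrimitiveRoot ζ (p ^ n)) (n : ℕ) :
    ∃ G : WittVector p R, frobenius G = verschiebung^[n] 1 := by
  obtain ⟨ζ, h⟩ := hζ (n + 1)
  have h' : IsPrimitiveRoot (ζ ^ p) (p ^ n) :=
    h.pow (Nat.pos_of_ne_zero (pow_ne_zero _ hp.out.ne_zero)) (pow_succ' p n)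
  refine ⟨∑ i ∈ range (p ^ n), teichmuller p (ζ ^ i), ?_⟩
  rw [map_sum, ← sum_teichmuller_pow h']
  refine sum_congr rfl fun i _ => ?_
  rw [frobenius_teichmuller, ← pow_mul, ← pow_mul, mul_comm]

theorem exists_frobenius_eq_iterate_verschiebung_one_map {S : Type*} [CommRing S] (f : R →+* S)
    (n : ℕ) (h : ∃ G : WittVector p R, frobenius G = verschiebung^[n] 1) :
    ∃ G : WittVector p S, frobenius G = verschiebung^[n] 1 := by
  obtain ⟨G, hG⟩ := h
  refine ⟨WittVector.map f G, ?_⟩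
  rw [← map_frobenius_eq, hG]
  clear hG
  induction n with
  | zero => simp
  | succ n ih => simp only [Function.iterate_succ_apply', map_verschiebung, ih]

/-- Successive approximation. If the error is `V^n z`, write `z_0 = s^(p^(n+1)) + p t`. The
projection formula gives `F([s] G) = V^n [s^(p^(n+1))]`, and `FV = p` gives `F(V^(n+1) [t]) = V^n (p
[t])`; their sum cancels component `n`. -/
theorem truncate_frobenius_surjective
    (hG : ∀ n, ∃ G : WittVector p R, frobenius G = verschiebung^[n] 1)
    (hF : ∀ r : R, ∃ s t, r = s ^ p + p * t) (n : ℕ) (y : WittVector p R) :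
    ∃ x : WittVector p R, ∀ i < n, (y - frobenius x).coeff i = 0 := by
  induction n with
  | zero => exact ⟨0, by simp⟩
  | succ n ih =>
    obtain ⟨x, hx⟩ := ih
    set z := (y - frobenius x).shift n with hz
    have hyz : y - frobenius x = verschiebung^[n] z := eq_iterate_verschiebung hx
    obtain ⟨s, t, hst⟩ := exists_eq_pow_prime_pow_add hF (n + 1) (z.coeff 0)
    obtain ⟨G, hGn⟩ := hG n
    refine ⟨x + (teichmuller p s * G + verschiebung^[n + 1] (teichmuller p t)), ?_⟩
    have key : frobenius (teichmuller p s * G + verschiebung^[n + 1] (teichmuller p t)) =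
        verschiebung^[n]
          (teichmuller p (s ^ p ^ (n + 1)) + teichmuller p t * (p : WittVector p R)) := by
      rw [map_add, map_mul, hGn, mul_comm, iterate_verschiebung_mul_left, one_mul,
        ← Function.iterate_succ_apply, frobenius_iterate_teichmuller, iterate_verschiebung_add,
        Function.iterate_succ_apply', frobenius_verschiebung, iterate_verschiebung_mul_left,
        ← RingHom.coe_pow, map_natCast]
    rw [map_add, key, ← sub_sub, hyz]
    rw [← iterate_verschiebung_sub]
    intro i hi
    rcases Nat.lt_succ_iff_lt_or_eq.mp hi with h | rfl
    · exact iterate_verschiebung_coeff_eq_zero _ h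
    · have := iterate_verschiebung_coeff
        (z - (teichmuller p (s ^ p ^ (i + 1)) + teichmuller p t * (p : WittVector p R))) i 0
      rw [zero_add] at this
      rw [this]
      rw [← constantCoeff_apply]
      rw [map_sub, map_add, map_mul, map_natCast]
      simp only [constantCoeff_apply]
      rw [teichmuller_coeff_zero, teichmuller_coeff_zero, hst]
      ring

theorem frobeniusSurjectiveFiniteLevels_of
    (hG : ∀ n, ∃ G : WittVector p R, frobenius G = verschiebung^[n] 1)
    (hF : ∀ r : R, ∃ s t, r = s ^ p + p * t) : FrobeniusSurjectiveFiniteLevels p R := by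
  intro n _ y
  obtain ⟨y, rfl⟩ := truncate_surjective p n R y
  obtain ⟨x, hx⟩ := truncate_frobenius_surjective hG hF n y
  refine ⟨truncate (n + 1) x, ?_⟩
  rw [truncatedFrobenius_truncate]
  symm
  rw [← sub_eq_zero, ← map_sub]
  exact (mem_ker_truncate n _).mpr hx

end FiniteLevels

/-! ### Teichmüller elements in the image of Frobenius -/

section Teichmuller

open WittVector

variable {p : ℕ} [hp : Fact p.Prime] {R : Type*} [CommRing R]

theorem aeval_mem_of_coeff_mem {I : Ideal R} (P : MvPolynomial ℕ ℤ) (x y : ℕ → R)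
    (h : ∀ i, x i - y i ∈ I) : MvPolynomial.aeval x P - MvPolynomial.aeval y P ∈ I := by
  rw [← Ideal.Quotient.eq, ← Ideal.Quotient.mkₐ_eq_mk ℤ, ← AlgHom.comp_apply,
    ← AlgHom.comp_apply, MvPolynomial.comp_aeval, MvPolynomial.comp_aeval]
  congr 2
  ext i
  exact Ideal.Quotient.eq.mpr (h i)

theorem coeff_frobenius_eq (x : WittVector p R) (i : ℕ) :
    (frobenius x).coeff i =
      x.coeff i ^ p + p * MvPolynomial.aeval x.coeff (frobeniusPolyAux p i) := by
  rw [coeff_frobenius, frobeniusPoly]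
  simp

/-- `F [r] = [r ^ p]`, in terms of the polynomials defining `F`. -/
theorem aeval_teichmuller_frobeniusPolyAux (r : R) (i : ℕ) (hi : i ≠ 0) :
    MvPolynomial.aeval (teichmuller p r).coeff (frobeniusPolyAux p i) = 0 := by
  have hX : MvPolynomial.aeval (teichmuller p (Polynomial.X : Polynomial ℤ)).coeff
      (frobeniusPolyAux p i) = 0 := by
    have h := coeff_frobenius_eq (teichmuller p (Polynomial.X : Polynomial ℤ)) i
    rw [frobenius_teichmuller, teichmuller_coeff_pos _ _ _ (Nat.pos_of_ne_zero hi),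
      teichmuller_coeff_pos _ _ _ (Nat.pos_of_ne_zero hi), zero_pow hp.out.ne_zero, zero_add] at h
    exact (mul_eq_zero.mp h.symm).resolve_left (Nat.cast_ne_zero.mpr hp.out.ne_zero)
  have h2 := congrArg (Polynomial.aeval r) hX
  rw [map_zero, ← AlgHom.comp_apply, MvPolynomial.comp_aeval] at h2
  rw [← h2]
  congr 2
  ext n
  cases n with
  | zero => simp
  | succ n => simp [teichmuller_coeff_pos _ _ _ (Nat.succ_pos n)]

theorem mem_IIdeal_succ {i : ℕ} {r : R} :
    r ∈ IIdeal p R (i + 1) ↔ ∃ s ∈ IIdeal p R i, r ^ p = p * s := Iff.rfl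

/-- With `f` the polynomial `frobeniusPolyAux p (i + 1)`, vanishing of component `i + 1` of `[r]`
says `x_{i+1}^p = -p f(x)`. If the higher components lie in `I_k`, then `f(x) ≡ f([x_0]) = 0` modulo
`I_k`, so `x_{i+1}` lies in `I_{k+1}`. -/
theorem coeff_mem_IIdeal {x : WittVector p R} {r : R} (h : frobenius x = teichmuller p r)
    (k i : ℕ) : x.coeff (i + 1) ∈ IIdeal p R k := by
  induction k generalizing i with
  | zero => trivial
  | succ k ih =>
    have h1 := coeff_frobenius_eq x (i + 1)
    rw [h, teichmuller_coeff_pos _ _ _ (Nat.succ_pos i)] at h1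
    refine mem_IIdeal_succ.mpr ⟨-MvPolynomial.aeval x.coeff (frobeniusPolyAux p (i + 1)), ?_, ?_⟩
    · refine neg_mem ?_
      have h2 := aeval_mem_of_coeff_mem (I := IIdeal p R k) (frobeniusPolyAux p (i + 1)) x.coeff
        (teichmuller p (x.coeff 0)).coeff fun j => by
          cases j with
          | zero => simp
          | succ j =>
            rw [teichmuller_coeff_pos _ _ _ (Nat.succ_pos j), sub_zero]
            exact ih j
      rwa [aeval_teichmuller_frobeniusPolyAux _ _ (Nat.succ_ne_zero i), sub_zero] at h2
    · linear_combination -h1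

theorem mem_pIInfty {y : R} : y ∈ pIInfty p R ↔ ∃ s ∈ IInfty p R, p * s = y :=
  Ideal.mem_span_singleton_mul

theorem mem_IInfty {y : R} : y ∈ IInfty p R ↔ ∀ i, y ∈ IIdeal p R i := by
  simp [IInfty]

theorem exists_pow_sub_mem_of_teichmullerInFrobeniusImage
    (h : TeichmullerInFrobeniusImage p R) (r : R) : ∃ x : R, x ^ p - r ∈ pIInfty p R := by
  obtain ⟨x, hx⟩ := h r
  refine ⟨x.coeff 0, mem_pIInfty.mpr ⟨-x.coeff 1, ?_, ?_⟩⟩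
  · exact neg_mem (mem_IInfty.mpr fun i => coeff_mem_IIdeal hx i 0)
  · have h1 := coeff_frobenius_eq x 0
    rw [hx, teichmuller_coeff_zero, frobeniusPolyAux_eq] at h1
    simp only [zero_add, MvPolynomial.aeval_X, Finset.range_zero, Finset.sum_empty, sub_zero] at h1
    linear_combination h1

theorem exists_pow_sub_mem_of_pthPowerSurjective
    (h : PthPowerSurjectiveModPIInfty p R) (r : R) : ∃ x : R, x ^ p - r ∈ pIInfty p R := by
  obtain ⟨x, hx⟩ := h (Ideal.Quotient.mk _ r)
  obtain ⟨x, rfl⟩ := Ideal.Quotient.mk_surjective x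
  exact ⟨x, Ideal.Quotient.eq.mp (by simpa using hx)⟩

end Teichmuller

/-! ### Congruences between polynomials in `ζ - 1` -/

section Polynomials

open Polynomial

variable {p : ℕ} [hp : Fact p.Prime]

theorem coeff_pow_card (h : (ZMod p)[X]) (j : ℕ) :
    (h ^ p).coeff j = if p ∣ j then h.coeff (j / p) else 0 := by
  rw [← ZMod.expand_card, coeff_expand hp.out.pos]

/-- Degree `0` gives `h_0 = 1`. Degree `p(p^n - p^c)` gives `h_{p^n - p^c} = h_{p^n - p^(c+1)}`, so
the value `1` propagates to `h_{p^n - 1}`. Degree `p^(n+1) - 1` is prime to `p`, so `h^p`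
contributes nothing there and `h_{p^n - 1}` must vanish. -/
theorem not_X_pow_dvd_pow_sub (n : ℕ) (h : (ZMod p)[X])
    (hd : X ^ p ^ (n + 1) ∣ h ^ p - X ^ ((p - 1) * p ^ n) * h - 1) : False := by
  have hp1 := hp.out.one_lt
  obtain ⟨m, rfl⟩ : ∃ m, p = m + 2 := ⟨p - 2, by omega⟩
  rw [X_pow_dvd_iff] at hd
  have hc : ∀ j < (m + 2) ^ (n + 1),
      (if m + 2 ∣ j then h.coeff (j / (m + 2)) else 0) -
        (if (m + 1) * (m + 2) ^ n ≤ j then h.coeff (j - (m + 1) * (m + 2) ^ n) else 0) -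
        (if j = 0 then 1 else 0) = 0 := by
    intro j hj
    have := hd j hj
    rw [coeff_sub, coeff_sub, coeff_pow_card, coeff_X_pow_mul', coeff_one] at this
    exact this
  have hpos : ∀ k, 0 < (m + 2) ^ k := fun k => by positivity
  have claim : ∀ b, b ≤ n → h.coeff ((m + 2) ^ n - (m + 2) ^ (n - b)) = 1 := by
    intro b
    induction b with
    | zero =>
      intro _
      have := hc 0 (hpos _)
      rw [if_pos (dvd_zero _), if_neg (by have := hpos n; nlinarith), if_pos rfl] at this
      simpa [sub_eq_zero] using this
    | succ b ih =>
      intro hb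
      have ih := ih (by omega)
      set c := n - (b + 1) with hcdef
      have hcb : n - b = c + 1 := by omega
      rw [hcb] at ih
      have hlt : (m + 2) ^ c < (m + 2) ^ n := Nat.pow_lt_pow_right (by omega) (by omega)
      have hle : (m + 2) ^ (c + 1) ≤ (m + 2) ^ n := Nat.pow_le_pow_right (by omega) (by omega)
      have h0 := hpos c
      have e2 : (m + 2) ^ (c + 1) = (m + 2) * (m + 2) ^ c := pow_succ' _ _
      have e1 : (m + 2) ^ (n + 1) = (m + 2) * (m + 2) ^ n := pow_succ' _ _
      have e4 : (m + 2) * (m + 2) ^ n = (m + 1) * (m + 2) ^ n + (m + 2) ^ n := by ring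
      have e5 : (m + 2) * ((m + 2) ^ n - (m + 2) ^ c) =
          (m + 2) * (m + 2) ^ n - (m + 2) * (m + 2) ^ c := Nat.mul_sub _ _ _
      have := hc ((m + 2) * ((m + 2) ^ n - (m + 2) ^ c))
        (by rw [e1]; exact Nat.mul_lt_mul_of_pos_left (by omega) (by omega))
      rw [if_pos (dvd_mul_right _ _), Nat.mul_div_cancel_left _ (by omega), if_pos (by omega),
        if_neg (Nat.mul_ne_zero (by omega) (by omega)),
        show (m + 2) * ((m + 2) ^ n - (m + 2) ^ c) - (m + 1) * (m + 2) ^ n =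
          (m + 2) ^ n - (m + 2) ^ (c + 1) by omega, ih] at this
      simpa [sub_eq_zero] using this
  have h1 := claim n le_rfl
  rw [Nat.sub_self, pow_zero] at h1
  have h0 := hpos n
  have e1 : (m + 2) ^ (n + 1) = (m + 2) * (m + 2) ^ n := pow_succ' _ _
  have e4 : (m + 2) * (m + 2) ^ n = (m + 1) * (m + 2) ^ n + (m + 2) ^ n := by ring
  have e6 : (m + 2) ^ n ≤ (m + 1) * (m + 2) ^ n := Nat.le_mul_of_pos_left _ (by omega)
  have := hc ((m + 2) ^ (n + 1) - 1) (by omega)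
  rw [if_neg, if_pos (by omega), if_neg (by omega),
    show (m + 2) ^ (n + 1) - 1 - (m + 1) * (m + 2) ^ n = (m + 2) ^ n - 1 by omega, h1] at this
  · simp at this
  · intro hdvd
    have h2 : m + 2 ∣ (m + 2) ^ (n + 1) := dvd_pow_self _ (by omega)
    have h3 := Nat.dvd_sub h2 hdvd
    rw [Nat.sub_sub_self (by omega)] at h3
    have := Nat.le_of_dvd one_pos h3
    omega

/-- Put `N = 2^a`. Low degrees determine `h_i` for `i < 2N`: it is `1` at `0` and `N` only. Odd
degrees above `4N` kill `h_l` for odd `l < 4N`. Degrees `4N + 2l` give `h_{2N+l} = h_l + h_{2l}`,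
which yields `h_{3N} = 1` and carries this value along the indices `4N - 2^c` to the odd index `4N -
1`. -/
theorem not_X_pow_dvd_of_two (a : ℕ) (h : (ZMod 2)[X])
    (hd : X ^ 2 ^ (a + 3) ∣ (1 + X ^ 2 ^ (a + 2)) * h ^ 2 + X ^ 2 ^ (a + 2) * h - 1 -
      X ^ 2 ^ (a + 1)) : False := by
  rw [X_pow_dvd_iff] at hd
  have e3 : 2 ^ (a + 3) = 8 * 2 ^ a := by ring
  have e2 : 2 ^ (a + 2) = 4 * 2 ^ a := by ring
  have e1 : 2 ^ (a + 1) = 2 * 2 ^ a := by ring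
  rw [e1, e2, e3] at hd
  set N := 2 ^ a with hN
  have hN0 : 0 < N := by positivity
  have hc : ∀ j < 8 * N,
      (if 2 ∣ j then h.coeff (j / 2) else 0) +
        (if 4 * N ≤ j then (if 2 ∣ j - 4 * N then h.coeff ((j - 4 * N) / 2) else 0) else 0) +
        (if 4 * N ≤ j then h.coeff (j - 4 * N) else 0) -
        (if j = 0 then 1 else 0) - (if j = 2 * N then 1 else 0) = 0 := by
    intro j hj
    have := hd j hj
    rw [coeff_sub, coeff_sub, coeff_add, add_mul, coeff_add, one_mul, coeff_X_pow_mul',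
      coeff_X_pow_mul', coeff_pow_card, coeff_one, coeff_X_pow, coeff_pow_card] at this
    exact this
  have h0 : h.coeff 0 = 1 := by
    have := hc 0 (by omega)
    rw [if_pos (dvd_zero _), if_neg (by omega), if_neg (by omega), if_pos rfl,
      if_neg (by omega)] at this
    simpa [sub_eq_zero] using this
  have hlow : ∀ i, 0 < i → i < 2 * N → h.coeff i = if i = N then 1 else 0 := by
    intro i hi0 hi
    have := hc (2 * i) (by omega)
    rw [if_pos (dvd_mul_right _ _), if_neg (by omega), if_neg (by omega), if_neg (by omega),
      Nat.mul_div_cancel_left _ two_pos] at this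
    simp only [add_zero, sub_zero, sub_eq_zero] at this
    rw [this]
    congr 1
    simp
  have hodd : ∀ l, l < 4 * N → ¬ 2 ∣ l → h.coeff l = 0 := by
    intro l hl hl2
    have := hc (4 * N + l) (by omega)
    rw [if_neg (by omega), if_pos (by omega), if_neg (by omega), if_pos (by omega),
      if_neg (by omega), if_neg (by omega), Nat.add_sub_cancel_left] at this
    simpa using this
  have hhigh : ∀ l, 2 * l < 4 * N →
      h.coeff (2 * N + l) + h.coeff l + h.coeff (2 * l) = 0 := by
    intro l hl
    have := hc (4 * N + 2 * l) (by omega)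
    rw [if_pos (by omega), if_pos (by omega), if_pos (by omega), if_pos (by omega),
      if_neg (by omega), if_neg (by omega), Nat.add_sub_cancel_left,
      show (4 * N + 2 * l) / 2 = 2 * N + l by omega, show 2 * l / 2 = l by omega] at this
    simpa using this
  have hmid : h.coeff (2 * N) = 0 := by
    have := hhigh 0 (by omega)
    rw [add_zero, mul_zero, h0, add_assoc, CharTwo.add_self_eq_zero, add_zero] at this
    exact this
  have claim : ∀ b, b ≤ a → h.coeff (4 * N - 2 ^ (a - b)) = 1 := by
    intro b
    induction b with
    | zero =>
      intro _
      have := hhigh N (by omega)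
      rw [hmid, hlow N hN0 (by omega), if_pos rfl, add_zero] at this
      rw [Nat.sub_zero, ← hN, show 4 * N - N = 2 * N + N by omega]
      exact CharTwo.add_eq_zero.mp this
    | succ b ih =>
      intro hb
      have ih := ih (by omega)
      set c := a - (b + 1) with hcdef
      rw [show a - b = c + 1 by omega] at ih
      have e : 2 ^ (c + 1) = 2 * 2 ^ c := pow_succ' _ _
      have hlt : 2 ^ c < N := Nat.pow_lt_pow_right (by omega) (by omega)
      have hpos : 0 < 2 ^ c := by positivity
      have := hhigh (2 * N - 2 ^ c) (by omega)
      rw [hlow (2 * N - 2 ^ c) (by omega) (by omega), if_neg (by omega),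
        show 2 * (2 * N - 2 ^ c) = 4 * N - 2 ^ (c + 1) by omega, ih, add_zero,
        show 2 * N + (2 * N - 2 ^ c) = 4 * N - 2 ^ c by omega] at this
      exact CharTwo.add_eq_zero.mp this
  have h1 := claim a le_rfl
  rw [Nat.sub_self, pow_zero, hodd _ (by omega) (by omega)] at h1
  exact zero_ne_one h1

theorem toZMod_eq_zero_iff (c : ℤ_[p]) : PadicInt.toZMod c = 0 ↔ (p : ℤ_[p]) ∣ c := by
  rw [← RingHom.mem_ker, PadicInt.ker_toZMod, PadicInt.maximalIdeal_eq_span_p,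
    Ideal.mem_span_singleton]

theorem exists_eq_X_pow_mul_add {j : ℕ} {f : ℤ_[p][X]} (h : X ^ j ∣ f.map PadicInt.toZMod) :
    ∃ k r : ℤ_[p][X], f = X ^ j * k + C (p : ℤ_[p]) * r := by
  obtain ⟨g, hg⟩ := h
  obtain ⟨k, rfl⟩ := Polynomial.map_surjective _ (ZMod.ringHom_surjective PadicInt.toZMod) g
  have : C (p : ℤ_[p]) ∣ f - X ^ j * k := by
    rw [C_dvd_iff_dvd_coeff]
    intro i
    rw [← toZMod_eq_zero_iff, ← coeff_map]
    simp [hg]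
  obtain ⟨r, hr⟩ := this
  exact ⟨k, r, by rw [← hr]; ring⟩

variable {O : Type*} [CommRing O] [IsDomain O]

/-- Evaluating the cyclotomic polynomial at `1` gives `p` as the product of all `1 - μ`, `μ`
primitive, and each factor is associated to `ζ - 1`. -/
theorem associated_sub_one_pow {ζ : O} {n : ℕ} (hζ : IsPrimitiveRoot ζ (p ^ (n + 1))) :
    Associated ((ζ - 1) ^ (p ^ n * (p - 1))) (p : O) := by
  have hpos : 0 < p ^ (n + 1) := pow_pos hp.out.pos _
  have h := eval_one_cyclotomic_prime_pow (R := O) (p := p) n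
  rw [cyclotomic_eq_prod_X_sub_primitiveRoots hζ, eval_prod] at h
  rw [← h, ← Nat.totient_prime_pow_succ hp.out, ← hζ.card_primitiveRoots, ← Finset.prod_const]
  refine Associated.prod _ _ _ fun μ hμ => ?_
  rw [mem_primitiveRoots hpos] at hμ
  obtain ⟨i, _, hi, rfl⟩ := (hζ.isPrimitiveRoot_iff).mp hμ
  rw [eval_sub, eval_X, eval_C]
  exact (hζ.associated_sub_one_pow_sub_one_of_coprime hi).trans (by
    rw [← neg_sub]; exact (Associated.refl _).neg_left)

theorem exists_one_add_pow_eq {S : Type*} [CommRing S] (hp2 : p ≠ 2) (w : S) :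
    ∃ c, (1 + w) ^ p = 1 + p * w + w ^ p + p * (w ^ 2 * c) := by
  have := hp.out.two_le
  obtain ⟨m, hm⟩ : ∃ m, p = m + 3 := ⟨p - 3, by omega⟩
  refine ⟨∑ i ∈ Finset.range (m + 1), w ^ i * ((p.choose (i + 2) / p : ℕ) : S), ?_⟩
  rw [add_comm, add_pow, Finset.sum_range_succ, show p = m + 1 + 1 + 1 from hm]
  rw [Finset.sum_range_succ', Finset.sum_range_succ', ← hm, Finset.mul_sum, Finset.mul_sum]
  have : ∀ i ∈ Finset.range (m + 1), w ^ (i + 1 + 1) * 1 ^ (p - (i + 1 + 1)) *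
      ((p.choose (i + 1 + 1) : ℕ) : S) =
      p * (w ^ 2 * (w ^ i * ((p.choose (i + 2) / p : ℕ) : S))) := by
    intro i hi
    rw [Finset.mem_range] at hi
    have hdvd := hp.out.dvd_choose_self (k := i + 2) (by omega) (by omega)
    conv_lhs => rw [show i + 1 + 1 = i + 2 from rfl, ← Nat.mul_div_cancel' hdvd]
    push_cast
    ring
  rw [Finset.sum_congr rfl this]
  simp
  ring

variable [Algebra ℤ_[p] O]

/-- The constant term of `f` is divisible by the nonunit `lam`, so it is a nonunit of `ℤ_p`, hence
divisible by `p` and by `lam ^ d`. Dropping it and cancelling one `lam` leads to `f.divX`. -/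
theorem X_pow_dvd_map_of_pow_dvd_aeval {lam : O} {d : ℕ} (hu : ¬ IsUnit lam) (h0 : lam ≠ 0)
    (hd : lam ^ d ∣ (p : O)) {j : ℕ} (hj : j ≤ d) (f : ℤ_[p][X]) (h : lam ^ j ∣ aeval lam f) :
    X ^ j ∣ f.map PadicInt.toZMod := by
  induction j generalizing f with
  | zero => simp
  | succ j ih =>
    have hf := f.X_mul_divX_add
    have hfl : aeval lam f = lam * aeval lam f.divX + algebraMap ℤ_[p] O (f.coeff 0) := by
      conv_lhs => rw [← hf]
      rw [map_add, map_mul, aeval_X, aeval_C]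
    have h1 : lam ∣ algebraMap ℤ_[p] O (f.coeff 0) := by
      have := (dvd_pow_self lam (Nat.succ_ne_zero j)).trans h
      rw [hfl] at this
      exact (dvd_add_right (dvd_mul_right _ _)).mp this
    have h2 : (p : ℤ_[p]) ∣ f.coeff 0 := by
      rw [← PadicInt.norm_lt_one_iff_dvd]
      by_contra hc
      refine hu (isUnit_of_dvd_unit h1 (IsUnit.map _ (PadicInt.isUnit_iff.mpr ?_)))
      exact le_antisymm (PadicInt.norm_le_one _) (not_lt.mp hc)
    have h3 : lam ^ (j + 1) ∣ algebraMap ℤ_[p] O (f.coeff 0) := by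
      refine ((pow_dvd_pow lam hj).trans hd).trans ?_
      simpa using map_dvd (algebraMap ℤ_[p] O) h2
    rw [hfl, dvd_add_left h3, pow_succ', mul_dvd_mul_iff_left h0] at h
    have h4 := ih (by omega) _ h
    rw [← hf, Polynomial.map_add, Polynomial.map_mul, map_X, map_C,
      (toZMod_eq_zero_iff _).mpr h2, C_0, add_zero, pow_succ']
    exact mul_dvd_mul_left _ h4

end Polynomials

/-! ### The congruences have no solution -/

section Cyclotomic

open Polynomial

variable {p : ℕ} [hp : Fact p.Prime] {O : Type*} [CommRing O] [IsDomain O]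

theorem sub_one_ne_zero_of_isPrimitiveRoot {S : Type*} [CommRing S] {ζ : S} {n : ℕ}
    (hζ : IsPrimitiveRoot ζ (p ^ (n + 1))) : ζ - 1 ≠ 0 :=
  sub_ne_zero.mpr (hζ.ne_one (Nat.one_lt_pow (Nat.succ_ne_zero n) hp.out.one_lt))

theorem not_isUnit_sub_one_of_isPrimitiveRoot (hpu : ¬ IsUnit (p : O)) {ζ : O} {n : ℕ}
    (hζ : IsPrimitiveRoot ζ (p ^ (n + 1))) : ¬ IsUnit (ζ - 1) :=
  fun h => hpu ((associated_sub_one_pow hζ).isUnit (h.pow _))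

theorem natCast_prime_ne_zero_of_isPrimitiveRoot {ζ : O} {n : ℕ}
    (hζ : IsPrimitiveRoot ζ (p ^ (n + 1))) : (p : O) ≠ 0 :=
  (associated_sub_one_pow hζ).ne_zero_iff.mp (pow_ne_zero _ (sub_one_ne_zero_of_isPrimitiveRoot hζ))

theorem dvd_pow_of_one_add_pow {S : Type*} [CommRing S] {y c : S}
    (h : (1 + y) ^ p = 1 + p * c) : (p : S) ∣ y ^ p := by
  obtain ⟨r, hr⟩ := exists_add_pow_prime_eq hp.out 1 y
  rw [one_pow, h] at hr
  exact ⟨c - y * r, by linear_combination -hr⟩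

theorem exists_pow_sub_one_eq_neg (hp2 : p ≠ 2) {ω : O} (hω : IsPrimitiveRoot ω p) :
    ∃ c, (ω - 1) ^ (p - 1) = -(p * (1 + (ω - 1) * c)) := by
  obtain ⟨c, hc⟩ := exists_one_add_pow_eq hp2 (ω - 1)
  have h0 : ω - 1 ≠ 0 := sub_ne_zero.mpr (hω.ne_one hp.out.one_lt)
  refine ⟨c, mul_left_cancel₀ h0 ?_⟩
  rw [← pow_succ', Nat.sub_add_cancel hp.out.one_le]
  rw [add_sub_cancel, hω.pow_eq_one] at hc
  linear_combination -hc

variable [Algebra ℤ_[p] O]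

/-- If `p` divides `y ^ p` with `y` a polynomial in `ζ - 1`, then `(ζ - 1) ^ (p ^ n * (p - 1))`
divides `y` up to a multiple of `p`. -/
theorem exists_eq_pow_mul_add_of_dvd_pow (hpu : ¬ IsUnit (p : O)) {ζ : O} {n : ℕ}
    (hζ : IsPrimitiveRoot ζ (p ^ (n + 2))) {g : ℤ_[p][X]} (h : (p : O) ∣ aeval (ζ - 1) g ^ p) :
    ∃ k r : ℤ_[p][X], g = X ^ ((p - 1) * p ^ n) * k + C (p : ℤ_[p]) * r := by
  have hass := associated_sub_one_pow hζ
  have h1 : X ^ (p ^ (n + 1) * (p - 1)) ∣ (g ^ p).map PadicInt.toZMod := by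
    refine X_pow_dvd_map_of_pow_dvd_aeval (lam := ζ - 1)
      (not_isUnit_sub_one_of_isPrimitiveRoot hpu hζ) (sub_one_ne_zero_of_isPrimitiveRoot hζ)
      hass.dvd le_rfl _ ?_
    rw [map_pow]
    exact hass.dvd.trans h
  -- The exponent is `p` times `(p - 1) p^n`, so a `p`-th root of the divisibility can be taken in
  -- `𝔽_p[X]`.
  rw [Polynomial.map_pow, show p ^ (n + 1) * (p - 1) = (p - 1) * p ^ n * p by ring, pow_mul,
    UniqueFactorizationMonoid.pow_dvd_pow_iff_dvd hp.out.ne_zero] at h1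
  exact exists_eq_X_pow_mul_add h1

/-- Let `λ = ζ - 1`, `L = ζ^(p^(n+1)) - 1`, `τ = λ^((p-1)p^n)`. The value of `g` is `1 + y` with `y
= τK + p r'`. Since `τ^p ≡ -p` modulo `pL`, expanding `(1 + y)^p` and dividing by `p` leaves `K^p -
τK - 1 ≡ 0` modulo `λ^(p^(n+1))`. -/
theorem not_exists_pow_eq_one_sub (hp2 : p ≠ 2) (hpu : ¬ IsUnit (p : O)) {n : ℕ} {ζ : O}
    (hζ : IsPrimitiveRoot ζ (p ^ (n + 2))) (g : ℤ_[p][X]) (q : O)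
    (h : aeval (ζ - 1) g ^ p = 1 - p + p * ((ζ ^ p ^ (n + 1) - 1) * q)) : False := by
  have hp3 : 3 ≤ p := by have := hp.out.two_le; omega
  have hpos : ∀ k, 0 < p ^ k := fun k => pow_pos hp.out.pos k
  have hp0 : (p : O) ≠ 0 := natCast_prime_ne_zero_of_isPrimitiveRoot hζ
  have hass := associated_sub_one_pow hζ
  have hω : IsPrimitiveRoot (ζ ^ p ^ (n + 1)) p := hζ.pow (hpos _) (pow_succ p (n + 1))
  obtain ⟨c₁, hc₁⟩ := exists_pow_sub_one_eq_neg hp2 hω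
  obtain ⟨p', hp'⟩ : (ζ ^ p ^ (n + 1) - 1) ^ 2 ∣ (p : O) := by
    have h1 := associated_sub_one_pow (O := O) (p := p) (n := 0) (by simpa using hω)
    rw [pow_zero, one_mul] at h1
    exact (pow_dvd_pow _ (by omega)).trans h1.dvd
  obtain ⟨b, hb⟩ := exists_add_pow_prime_pow_eq hp.out (ζ - 1) 1 (n + 1)
  rw [sub_add_cancel, one_pow, mul_one] at hb
  set lam := ζ - 1 with hlam
  set L := ζ ^ p ^ (n + 1) - 1 with hL
  -- `λ^(p^(n+1))` agrees with `L` modulo `L^2`, because `L^2` divides `p` for odd `p`.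
  have hT : lam ^ p ^ (n + 1) = L * (1 - L * (p' * lam * b)) := by
    linear_combination hL - hb - lam * b * hp'
  have hTp : lam ^ p ^ (n + 1) ∣ (p : O) :=
    (pow_dvd_pow _ (Nat.le_mul_of_pos_right _ (by omega))).trans hass.dvd
  have hTL : lam ^ p ^ (n + 1) ∣ L := by
    have : L = lam ^ p ^ (n + 1) + p * (lam * b) := by linear_combination hL + hb
    rw [this]
    exact dvd_add dvd_rfl (hTp.mul_right _)
  obtain ⟨c₂, hc₂⟩ : ∃ c, lam ^ (p ^ (n + 1) * (p - 1)) = -(p * (1 + L * c)) := by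
    obtain ⟨s, hs⟩ : L * (p' * lam * b) ∣ (1 - L * (p' * lam * b)) ^ (p - 1) - 1 := by
      have := sub_dvd_pow_sub_pow (1 - L * (p' * lam * b)) 1 (p - 1)
      rw [one_pow, sub_sub_cancel_left, neg_dvd] at this
      exact this
    refine ⟨c₁ + (1 + L * c₁) * (p' * lam * b) * s, ?_⟩
    rw [pow_mul, hT, mul_pow, hc₁]
    linear_combination -(p * (1 + L * c₁)) * hs
  obtain ⟨y, hy⟩ : ∃ y, y = aeval lam (g - 1) := ⟨_, rfl⟩
  have hgy : aeval lam g = 1 + y := by rw [hy, map_sub, map_one]; ring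
  rw [hgy] at h
  have hdy : (p : O) ∣ aeval lam (g - 1) ^ p := by
    rw [← hy]
    exact dvd_pow_of_one_add_pow (c := L * q - 1) (by rw [h]; ring)
  obtain ⟨k, r, hkr⟩ := exists_eq_pow_mul_add_of_dvd_pow hpu hζ hdy
  rw [hkr] at hy
  simp only [map_add, map_mul, map_pow, aeval_X, map_natCast] at hy
  set τ := lam ^ ((p - 1) * p ^ n) with hτ
  have hτp : τ ^ p = -(p * (1 + L * c₂)) := by
    rw [hτ, ← pow_mul, show (p - 1) * p ^ n * p = p ^ (n + 1) * (p - 1) by ring, hc₂]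
  -- Here `2(p - 1) ≥ p`; this makes the quadratic terms in `y` negligible.
  obtain ⟨t, ht⟩ : lam ^ p ^ (n + 1) ∣ τ ^ 2 := by
    rw [hτ, ← pow_mul]
    refine pow_dvd_pow _ ?_
    rw [pow_succ, mul_comm _ p, mul_right_comm]
    exact Nat.mul_le_mul_right _ (by omega)
  obtain ⟨c₃, hc₃⟩ := exists_one_add_pow_eq hp2 y
  obtain ⟨c₄, hc₄⟩ := exists_add_pow_prime_eq hp.out (τ * aeval lam k) (p * aeval lam r)
  have hpp : (p : O) ^ p = p * p * p ^ (p - 2) := by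
    rw [← pow_two, ← pow_add]; congr 1; omega
  rw [← hy, mul_pow, mul_pow, hτp, hpp] at hc₄
  rw [hc₃, hc₄] at h
  have key : lam ^ p ^ (n + 1) ∣ aeval lam (k ^ p - X ^ ((p - 1) * p ^ n) * k - 1) := by
    rw [map_sub, map_sub, map_pow, map_mul, map_pow, aeval_X, map_one, ← hτ]
    set K := aeval lam k
    set r' := aeval lam r
    have hcancel : K ^ p - τ * K - 1 =
        L * (-q - c₂ * K ^ p) + p * (r' + p ^ (p - 2) * r' ^ p + τ * K * r' * c₄) + y ^ 2 * c₃ := by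
      apply mul_left_cancel₀ hp0
      linear_combination -h + p * hy
    have hy2 : y ^ 2 = lam ^ p ^ (n + 1) * (t * K ^ 2) + p * (2 * τ * K * r' + p * r' ^ 2) := by
      rw [hy]
      linear_combination K ^ 2 * ht
    rw [hcancel]
    refine dvd_add (dvd_add (hTL.mul_right _) (hTp.mul_right _)) (Dvd.dvd.mul_right ?_ _)
    rw [hy2]
    exact dvd_add (dvd_mul_right _ _) (hTp.mul_right _)
  have h2 := X_pow_dvd_map_of_pow_dvd_aeval (not_isUnit_sub_one_of_isPrimitiveRoot hpu hζ)
    (sub_one_ne_zero_of_isPrimitiveRoot hζ) hass.dvd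
    (Nat.le_mul_of_pos_right _ (by omega)) _ key
  apply not_X_pow_dvd_pow_sub n (k.map PadicInt.toZMod)
  simpa using h2

end Cyclotomic

/-! ### The congruence for `p = 2` over a general domain -/

section CyclotomicTwo

open Polynomial

variable {O : Type*} [CommRing O] [IsDomain O] [Algebra ℤ_[2] O]

/-- With `j = ζ^(2^(a+2))`, `j^2 = -1`, one has `τ = λ^(2^(a+2)) ≡ j - 1` modulo `2`, whence `τ^2 ≡
-2(1 + τ)` modulo `4`. Expanding `(1 + τK + 2r')^2` and dividing by `2` gives `(1 + τ)K^2 + τK ≡ 1 +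
λ^(2^(a+1))` modulo `2`. -/
theorem not_exists_sq_eq_one_add (hpu : ¬ IsUnit (2 : O)) {a : ℕ} {ζ : O}
    (hζ : IsPrimitiveRoot ζ (2 ^ (a + 4))) (g : ℤ_[2][X]) (q : O)
    (h : aeval (ζ - 1) g ^ 2 = 1 + 2 * ζ ^ 2 ^ (a + 1) + 4 * q) : False := by
  have h2u : ¬ IsUnit ((2 : ℕ) : O) := by exact_mod_cast hpu
  have h20 : (2 : O) ≠ 0 := by exact_mod_cast natCast_prime_ne_zero_of_isPrimitiveRoot hζ
  have hass := associated_sub_one_pow hζ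
  have hd : (ζ - 1) ^ 2 ^ (a + 3) ∣ ((2 : ℕ) : O) := by simpa using hass.dvd
  have hj : (ζ ^ 2 ^ (a + 2)) ^ 2 = -1 := by
    have : IsPrimitiveRoot (ζ ^ 2 ^ (a + 3)) 2 := hζ.pow (by positivity) (pow_succ 2 (a + 3))
    rw [← pow_mul, ← pow_succ]
    exact this.eq_neg_one_of_two_right
  obtain ⟨b, hb⟩ := exists_add_pow_prime_pow_eq Nat.prime_two (ζ - 1) 1 (a + 2)
  obtain ⟨b', hb'⟩ := exists_add_pow_prime_pow_eq Nat.prime_two (ζ - 1) 1 (a + 1)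
  rw [sub_add_cancel, one_pow, mul_one, Nat.cast_ofNat] at hb hb'
  set lam := ζ - 1 with hlam
  set j := ζ ^ 2 ^ (a + 2)
  obtain ⟨y, hy⟩ : ∃ y, y = aeval lam (g - 1) := ⟨_, rfl⟩
  have hgy : aeval lam g = 1 + y := by rw [hy, map_sub, map_one]; ring
  rw [hgy] at h
  have hdy : ((2 : ℕ) : O) ∣ aeval lam (g - 1) ^ 2 := by
    rw [← hy]
    exact dvd_pow_of_one_add_pow (p := 2) (c := ζ ^ 2 ^ (a + 1) + 2 * q) (by
      rw [h]; push_cast; ring)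
  obtain ⟨k, r, hkr⟩ := exists_eq_pow_mul_add_of_dvd_pow (p := 2) h2u hζ hdy
  rw [hkr] at hy
  simp only [map_add, map_mul, map_pow, aeval_X, Nat.cast_ofNat, map_ofNat] at hy
  rw [show (2 - 1) * 2 ^ (a + 2) = 2 ^ (a + 2) by omega] at hy
  rw [hb', hy] at h
  have key : lam ^ 2 ^ (a + 3) ∣ aeval lam
      ((1 + X ^ 2 ^ (a + 2)) * k ^ 2 + X ^ 2 ^ (a + 2) * k - 1 - X ^ 2 ^ (a + 1)) := by
    simp only [map_sub, map_add, map_mul, map_pow, aeval_X, map_one]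
    refine hd.trans ?_
    set K := aeval lam k
    set r' := aeval lam r
    set τ := lam ^ 2 ^ (a + 2)
    set lB := lam * b
    have hτ : τ = j - 1 - 2 * lB := by simp only [lB]; linear_combination -hb
    refine ⟨(1 + τ) * K ^ 2 + lam * b' + q - r' - τ * K * r' - r' ^ 2 - (lB ^ 2 - lB * j) * K ^ 2,
      ?_⟩
    apply mul_left_cancel₀ h20
    push_cast
    have hτ2 : τ ^ 2 = -2 * (1 + τ) + 4 * (lB ^ 2 - lB * j) := by
      linear_combination (τ + 1 + j - 2 * lB) * hτ + hj
    linear_combination h - K ^ 2 * hτ2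
  have h2 := X_pow_dvd_map_of_pow_dvd_aeval (not_isUnit_sub_one_of_isPrimitiveRoot h2u hζ)
    (sub_one_ne_zero_of_isPrimitiveRoot hζ) hd le_rfl _ key
  apply not_X_pow_dvd_of_two a (k.map PadicInt.toZMod)
  simpa using h2

end CyclotomicTwo

/-! ### Functoriality of `I_∞` -/

section Functoriality

variable {p : ℕ} [hp : Fact p.Prime] {A B : Type*} [CommRing A] [CommRing B]

theorem map_mem_IIdeal (f : A →+* B) (i : ℕ) {r : A} (h : r ∈ IIdeal p A i) :
    f r ∈ IIdeal p B i := by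
  induction i generalizing r with
  | zero => trivial
  | succ i ih =>
    obtain ⟨s, hs, h⟩ := mem_IIdeal_succ.mp h
    exact mem_IIdeal_succ.mpr ⟨f s, ih hs, by rw [← map_pow, h, map_mul, map_natCast]⟩

theorem map_mem_pIInfty (f : A →+* B) {r : A} (h : r ∈ pIInfty p A) : f r ∈ pIInfty p B := by
  obtain ⟨s, hs, rfl⟩ := mem_pIInfty.mp h
  exact mem_pIInfty.mpr ⟨f s, mem_IInfty.mpr fun i => map_mem_IIdeal f i (mem_IInfty.mp hs i),
    by rw [map_mul, map_natCast]⟩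

theorem natCast_mem_IIdeal (i : ℕ) : (p : A) ∈ IIdeal p A i := by
  induction i with
  | zero => trivial
  | succ i ih =>
    refine mem_IIdeal_succ.mpr ⟨p ^ (p - 1), Ideal.pow_mem_of_mem _ ih _ ?_, ?_⟩
    · have := hp.out.two_le; omega
    · rw [← pow_succ', Nat.sub_add_cancel hp.out.one_le]

/-- If `A / p ≅ B / p`, then `p`-th powers modulo `p I_∞` can be detected in `A`. -/
theorem exists_pow_sub_mem_of_map (f : A →+* B) (hB : ∀ b : B, p * b = 0 → b = 0)
    (hs : ∀ b : B, ∃ a b', b = f a + p * b') (hi : ∀ a b, f a = p * b → ∃ a', a = p * a') (c : A)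
    (h : ∃ x : B, x ^ p - f c ∈ pIInfty p B) : ∃ x : A, x ^ p - c ∈ pIInfty p A := by
  have hcancel : ∀ b b' : B, p * b = p * b' → b = b' := fun b b' h =>
    sub_eq_zero.mp (hB _ (by rw [mul_sub, h, sub_self]))
  have hdiv : ∀ a b, f a = p * b → ∃ a', a = p * a' ∧ f a' = b := by
    intro a b hab
    obtain ⟨a', rfl⟩ := hi a b hab
    exact ⟨a', rfl, hcancel _ _ (by rw [← hab, map_mul, map_natCast])⟩
  have hI : ∀ i a, f a ∈ IIdeal p B i → a ∈ IIdeal p A i := by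
    intro i
    induction i with
    | zero => exact fun _ _ => trivial
    | succ i ih =>
      intro a ha
      obtain ⟨t, ht, h⟩ := mem_IIdeal_succ.mp ha
      obtain ⟨t', h1, rfl⟩ := hdiv (a ^ p) t (by rw [map_pow, h])
      exact mem_IIdeal_succ.mpr ⟨t', ih _ ht, h1⟩
  obtain ⟨x, hx⟩ := h
  obtain ⟨s, hsI, hsx⟩ := mem_pIInfty.mp hx
  -- Approximation modulo `p^2` suffices: the `p`-th power changes by a multiple of `p^2`, which
  -- lies in `p I_∞` because `p` is in every `I_i`.
  obtain ⟨a₀, b₀, rfl⟩ := hs x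
  obtain ⟨a₁, b₁, rfl⟩ := hs b₀
  obtain ⟨d, hd⟩ := sub_dvd_pow_sub_pow (f a₀ + p * (f a₁ + p * b₁)) (f a₀ + p * f a₁) p
  obtain ⟨s', h1, h2⟩ := hdiv ((a₀ + p * a₁) ^ p - c) (s - p * (b₁ * d)) (by
    simp only [map_sub, map_pow, map_add, map_mul, map_natCast]
    linear_combination -hsx - hd)
  refine ⟨a₀ + p * a₁, mem_pIInfty.mpr ⟨s', mem_IInfty.mpr fun i => hI i _ ?_, h1.symm⟩⟩
  rw [h2]
  exact sub_mem (mem_IInfty.mp hsI i) (Ideal.mul_mem_right _ _ (natCast_mem_IIdeal i))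

end Functoriality

/-! ### Rings generated by roots of unity of `p`-power order -/

section AdjoinMu

variable {p : ℕ} [hp : Fact p.Prime] {A K : Type*} [CommRing A] [Field K] [Algebra A K]

theorem mem_adjoinMuPInfty {p : ℕ} {A K : Type*} [CommRing A] [Field K] [Algebra A K] {ζ : K}
    {n : ℕ} (h : ζ ^ p ^ n = 1) : ζ ∈ adjoinMuPInfty p A K :=
  Algebra.subset_adjoin ⟨n, h⟩

theorem exists_isPrimitiveRoot_of_isAlgClosed [IsAlgClosed K] [CharZero K] (n : ℕ) (hn : n ≠ 0) :
    ∃ ζ : K, IsPrimitiveRoot ζ n := by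
  have : NeZero n := ⟨hn⟩
  exact HasEnoughRootsOfUnity.exists_primitiveRoot K n

theorem exists_isPrimitiveRoot_adjoinMuPInfty [IsAlgClosed K] [CharZero K] (n : ℕ) :
    ∃ ζ : adjoinMuPInfty p A K, IsPrimitiveRoot ζ (p ^ n) := by
  obtain ⟨ζ, h⟩ := exists_isPrimitiveRoot_of_isAlgClosed (K := K) (p ^ n)
    (pow_ne_zero _ hp.out.ne_zero)
  exact ⟨⟨ζ, mem_adjoinMuPInfty h.pow_eq_one⟩,
    IsPrimitiveRoot.of_map_of_injective (f := (adjoinMuPInfty p A K).val) h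
      Subtype.val_injective⟩

/-- The generators are exact `p`-th powers, and `p`-th powers modulo `p` are closed under sums and
products. -/
theorem exists_eq_pow_add_adjoinMuPInfty [IsAlgClosed K] (hA : ∀ a : A, ∃ s t, a = s ^ p + p * t)
    (r : adjoinMuPInfty p A K) : ∃ s t, r = s ^ p + p * t := by
  obtain ⟨r, hr⟩ := r
  induction hr using Algebra.adjoin_induction with
  | mem x hx =>
    obtain ⟨n, hn⟩ := hx
    obtain ⟨y, hy⟩ := IsAlgClosed.exists_pow_nat_eq x hp.out.pos
    refine ⟨⟨y, mem_adjoinMuPInfty (n := n + 1) ?_⟩, 0, ?_⟩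
    · rw [pow_succ', pow_mul, hy, hn]
    · ext
      simp [hy]
  | algebraMap a =>
    obtain ⟨s, t, h⟩ := hA a
    refine ⟨algebraMap A _ s, algebraMap A _ t, ?_⟩
    ext
    simp [h]
  | add x y hx hy h1 h2 =>
    obtain ⟨s, t, h1⟩ := h1
    obtain ⟨s', t', h2⟩ := h2
    obtain ⟨c, hc⟩ := exists_add_pow_prime_eq hp.out s s'
    refine ⟨s + s', t + t' - s * s' * c, ?_⟩
    change (⟨x, hx⟩ + ⟨y, hy⟩ : adjoinMuPInfty p A K) = _
    rw [h1, h2, hc]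
    ring
  | mul x y hx hy h1 h2 =>
    obtain ⟨s, t, h1⟩ := h1
    obtain ⟨s', t', h2⟩ := h2
    refine ⟨s * s', s ^ p * t' + t * s' ^ p + p * t * t', ?_⟩
    change (⟨x, hx⟩ * ⟨y, hy⟩ : adjoinMuPInfty p A K) = _
    rw [h1, h2]
    ring

theorem frobeniusSurjectiveFiniteLevels_adjoinMuPInfty [IsAlgClosed K] [CharZero K]
    (hA : ∀ a : A, ∃ s t, a = s ^ p + p * t) :
    FrobeniusSurjectiveFiniteLevels p (adjoinMuPInfty p A K) :=
  frobeniusSurjectiveFiniteLevels_of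
    (exists_frobenius_eq_iterate_verschiebung_one exists_isPrimitiveRoot_adjoinMuPInfty)
    (exists_eq_pow_add_adjoinMuPInfty hA)

theorem int_exists_eq_pow_add (a : ℤ) : ∃ s t, a = s ^ p + p * t := by
  have : (p : ℤ) ∣ a - a ^ p := by
    rw [← ZMod.intCast_zmod_eq_zero_iff_dvd]
    simp
  obtain ⟨t, ht⟩ := this
  exact ⟨a, t, by rw [← ht]; ring⟩

theorem padicInt_exists_eq_pow_add (a : ℤ_[p]) : ∃ s t, a = s ^ p + p * t := by
  have : (p : ℤ_[p]) ∣ a - a ^ p := by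
    rw [← toZMod_eq_zero_iff]
    simp
  obtain ⟨t, ht⟩ := this
  exact ⟨a, t, by rw [← ht]; ring⟩

/-- Every element of `A[μ_{p^∞}]` lies in `A[ζ]` for roots of unity `ζ` of large `p`-power order. -/
theorem exists_forall_mem_adjoin {x : K} (hx : x ∈ adjoinMuPInfty p A K) :
    ∃ N, ∀ n ≥ N, ∀ ζ : K, IsPrimitiveRoot ζ (p ^ n) → x ∈ Algebra.adjoin A {ζ} := by
  induction hx using Algebra.adjoin_induction with
  | mem x hx =>
    obtain ⟨m, hm⟩ := hx
    refine ⟨m, fun n hn ζ hζ => ?_⟩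
    have : NeZero (p ^ n) := ⟨pow_ne_zero _ hp.out.ne_zero⟩
    obtain ⟨c, hc⟩ := pow_dvd_pow p hn
    obtain ⟨i, _, rfl⟩ := hζ.eq_pow_of_pow_eq_one (ξ := x) (by rw [hc, pow_mul, hm, one_pow])
    exact pow_mem (Algebra.self_mem_adjoin_singleton A ζ) i
  | algebraMap a => exact ⟨0, fun _ _ _ _ => Subalgebra.algebraMap_mem _ a⟩
  | add x y _ _ h1 h2 =>
    obtain ⟨N, h1⟩ := h1
    obtain ⟨N', h2⟩ := h2
    exact ⟨max N N', fun n hn ζ hζ => add_mem (h1 n (le_of_max_le_left hn) ζ hζ)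
      (h2 n (le_of_max_le_right hn) ζ hζ)⟩
  | mul x y _ _ h1 h2 =>
    obtain ⟨N, h1⟩ := h1
    obtain ⟨N', h2⟩ := h2
    exact ⟨max N N', fun n hn ζ hζ => mul_mem (h1 n (le_of_max_le_left hn) ζ hζ)
      (h2 n (le_of_max_le_right hn) ζ hζ)⟩

open Polynomial in
theorem exists_aeval_sub_one_eq {x ζ : K} (hx : x ∈ Algebra.adjoin A {ζ}) :
    ∃ g : A[X], aeval (ζ - 1) g = x := by
  rw [Algebra.adjoin_singleton_eq_range_aeval] at hx
  obtain ⟨f, rfl⟩ := hx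
  exact ⟨f.comp (X + 1), by simp [aeval_comp]⟩

end AdjoinMu

/-! ### The integers of the algebraic closure of `ℚ_p` -/

section Integers

open Polynomial

variable (p : ℕ) [hp : Fact p.Prime]

theorem norm_algebraMap_padicInt (a : ℤ_[p]) : ‖algebraMap ℤ_[p] (PadicAlgCl p) a‖ = ‖a‖ := by
  rw [IsScalarTower.algebraMap_apply ℤ_[p] ℚ_[p] (PadicAlgCl p), PadicAlgCl.norm_extends]
  rfl

/-- The elements of norm at most `1` of the algebraic closure of `ℚ_p`. -/
def padicAlgClIntegers : Subalgebra ℤ_[p] (PadicAlgCl p) where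
  carrier := {x | ‖x‖ ≤ 1}
  mul_mem' := fun {x y} hx hy => by
    rw [Set.mem_ofPred_eq, norm_mul]
    exact mul_le_one₀ hx (norm_nonneg _) hy
  add_mem' := fun {x y} hx hy =>
    (PadicAlgCl.isNonarchimedean p x y).trans (max_le hx hy)
  algebraMap_mem' a := (norm_algebraMap_padicInt p a).trans_le (PadicInt.norm_le_one a)

variable {p}

theorem norm_natCast_prime : ‖(p : PadicAlgCl p)‖ = (p : ℝ)⁻¹ := by
  have := norm_algebraMap_padicInt p (p : ℤ_[p])
  rwa [map_natCast, PadicInt.norm_p] at this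

theorem norm_natCast_prime_pos : 0 < ‖(p : PadicAlgCl p)‖ := by
  rw [norm_natCast_prime]
  exact inv_pos.mpr (Nat.cast_pos.mpr hp.out.pos)

theorem norm_natCast_prime_lt_one : ‖(p : PadicAlgCl p)‖ < 1 := by
  rw [norm_natCast_prime]
  exact inv_lt_one_of_one_lt₀ (Nat.one_lt_cast.mpr hp.out.one_lt)

theorem norm_le_one_of_pow_eq_one {x : PadicAlgCl p} {n : ℕ} (hn : n ≠ 0) (h : x ^ n = 1) :
    ‖x‖ ≤ 1 :=
  (pow_le_one_iff_of_nonneg (norm_nonneg _) hn).mp (by rw [← norm_pow, h, norm_one])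

theorem adjoinMuPInfty_le_integers :
    adjoinMuPInfty p ℤ_[p] (AlgebraicClosure ℚ_[p]) ≤ padicAlgClIntegers p := by
  refine Algebra.adjoin_le ?_
  rintro x ⟨n, hn⟩
  exact norm_le_one_of_pow_eq_one (pow_ne_zero _ hp.out.ne_zero) hn

theorem norm_coe_le_one (x : padicAlgClIntegers p) : ‖(x : PadicAlgCl p)‖ ≤ 1 := x.2

theorem dvd_of_norm_le {x y : padicAlgClIntegers p}
    (h : ‖(x : PadicAlgCl p)‖ ≤ ‖(y : PadicAlgCl p)‖) : y ∣ x := by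
  by_cases hy : (y : PadicAlgCl p) = 0
  · rw [hy, norm_zero, norm_le_zero_iff] at h
    have : x = 0 := Subtype.ext h
    rw [this]
    exact dvd_zero _
  · refine ⟨⟨x / y, ?_⟩, Subtype.ext ?_⟩
    · change ‖(x / y : PadicAlgCl p)‖ ≤ 1
      rw [norm_div]
      exact div_le_one_of_le₀ h (norm_nonneg _)
    · exact (mul_div_cancel₀ _ hy).symm

theorem norm_le_of_dvd {x y : padicAlgClIntegers p} (h : y ∣ x) :
    ‖(x : PadicAlgCl p)‖ ≤ ‖(y : PadicAlgCl p)‖ := by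
  obtain ⟨z, rfl⟩ := h
  rw [Subalgebra.coe_mul, norm_mul]
  exact mul_le_of_le_one_right (norm_nonneg _) (norm_coe_le_one z)

theorem not_isUnit_natCast_prime : ¬ IsUnit (p : padicAlgClIntegers p) := by
  intro h
  have := norm_le_of_dvd h.dvd (y := (p : padicAlgClIntegers p)) (x := 1)
  simp only [Subalgebra.coe_one, norm_one] at this
  exact absurd norm_natCast_prime_lt_one (not_lt.mpr this)

theorem pow_mul_le_pow_of_pow_eq_mul {p : ℕ} {a b c : ℝ} {i : ℕ} (hb : 0 ≤ b) (h : a ^ p = b * c)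
    (e : p ^ i * (p - 1) + p ^ i = p ^ (i + 1)) (hc : c ^ (p ^ i * (p - 1)) * b ≤ b ^ p ^ i) :
    a ^ (p ^ (i + 1) * (p - 1)) * b ≤ b ^ p ^ (i + 1) := by
  rw [pow_succ' p i, mul_assoc, pow_mul, h, mul_pow, mul_assoc, ← pow_succ', ← e, pow_add]
  exact mul_le_mul_of_nonneg_left hc (by positivity)

/-- For the valuation with `v(p) = 1` this reads `v(s) ≥ (1 - p^(-i))/(p - 1)`, cleared of
denominators; the induction uses `p v(s) = 1 + v(t)`. -/
theorem norm_pow_le_of_mem_IIdeal (i : ℕ) {s : ZpMuPInfty p} (hs : s ∈ IIdeal p (ZpMuPInfty p) i) :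
    ‖(s : PadicAlgCl p)‖ ^ (p ^ i * (p - 1)) * ‖(p : PadicAlgCl p)‖ ≤
      ‖(p : PadicAlgCl p)‖ ^ p ^ i := by
  induction i generalizing s with
  | zero =>
    have h1 : ‖(s : PadicAlgCl p)‖ ≤ 1 := adjoinMuPInfty_le_integers s.2
    rw [pow_zero, one_mul, pow_one]
    exact mul_le_of_le_one_left (norm_nonneg _) (pow_le_one₀ (norm_nonneg _) h1)
  | succ i ih =>
    obtain ⟨t, ht, h⟩ := mem_IIdeal_succ.mp hs
    have h2 : ‖(s : PadicAlgCl p)‖ ^ p = ‖(p : PadicAlgCl p)‖ * ‖(t : PadicAlgCl p)‖ := by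
      have h3 := congrArg (adjoinMuPInfty p ℤ_[p] (AlgebraicClosure ℚ_[p])).val h
      rw [map_pow, map_mul, map_natCast] at h3
      rw [← norm_pow, ← norm_mul]
      exact congrArg norm h3
    have e : p ^ i * (p - 1) + p ^ i = p ^ (i + 1) := by
      rw [← Nat.mul_succ, pow_succ, Nat.succ_eq_add_one, Nat.sub_add_cancel hp.out.one_le]
    exact pow_mul_le_pow_of_pow_eq_mul (norm_nonneg _) h2 e (ih ht)

/-- The limit of the bounds for `I_n`: a ratio `a > 1` would have unbounded powers, while level `n`
gives `a^(p^n) ≤ |p|⁻¹`. -/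
theorem norm_pow_le_of_mem_IInfty {s : ZpMuPInfty p} (hs : s ∈ IInfty p (ZpMuPInfty p)) :
    ‖(s : PadicAlgCl p)‖ ^ (p - 1) ≤ ‖(p : PadicAlgCl p)‖ := by
  by_contra hlt
  rw [not_le] at hlt
  have hp0 := norm_natCast_prime_pos (p := p)
  set a := ‖(s : PadicAlgCl p)‖ ^ (p - 1) / ‖(p : PadicAlgCl p)‖ with ha
  have ha1 : 1 < a := (one_lt_div hp0).mpr hlt
  obtain ⟨n, hn⟩ := pow_unbounded_of_one_lt (‖(p : PadicAlgCl p)‖⁻¹) ha1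
  have h1 := norm_pow_le_of_mem_IIdeal n (mem_IInfty.mp hs n)
  have h2 : a ^ p ^ n ≤ ‖(p : PadicAlgCl p)‖⁻¹ := by
    rw [ha, div_pow, ← pow_mul, mul_comm (p - 1), div_le_iff₀ (by positivity), inv_mul_eq_div,
      le_div_iff₀ hp0]
    exact h1
  have h3 : a ^ n ≤ a ^ p ^ n := pow_le_pow_right₀ ha1.le (Nat.lt_pow_self hp.out.one_lt).le
  linarith

/-- A root of unity of `p`-power order, as an integral element. -/
theorem exists_integers_isPrimitiveRoot {ζ : PadicAlgCl p} {n : ℕ}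
    (hζ : IsPrimitiveRoot ζ (p ^ n)) :
    ∃ z : padicAlgClIntegers p, (z : PadicAlgCl p) = ζ ∧ IsPrimitiveRoot z (p ^ n) :=
  ⟨⟨ζ, norm_le_one_of_pow_eq_one (pow_ne_zero _ hp.out.ne_zero) hζ.pow_eq_one⟩, rfl,
    IsPrimitiveRoot.of_map_of_injective (f := (padicAlgClIntegers p).val) hζ
      Subtype.val_injective⟩

theorem not_exists_pow_sub_mem_of_ne_two (hp2 : p ≠ 2) :
    ¬ ∃ x : ZpMuPInfty p, x ^ p - (1 - (p : ZpMuPInfty p)) ∈ pIInfty p (ZpMuPInfty p) := by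
  rintro ⟨x, hx⟩
  obtain ⟨s, hs, hsx⟩ := mem_pIInfty.mp hx
  obtain ⟨N, hN⟩ := exists_forall_mem_adjoin x.2
  obtain ⟨ζ, hζ⟩ := exists_isPrimitiveRoot_of_isAlgClosed (K := PadicAlgCl p) (p ^ (N + 2))
    (pow_ne_zero _ hp.out.ne_zero)
  obtain ⟨g, hg⟩ := exists_aeval_sub_one_eq (hN (N + 2) (by omega) ζ hζ)
  obtain ⟨z, rfl, hz⟩ := exists_integers_isPrimitiveRoot hζ
  have hω : IsPrimitiveRoot (z ^ p ^ (N + 1)) (p ^ (0 + 1)) :=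
    hz.pow (pow_pos hp.out.pos _) (by ring)
  -- For a primitive `p`-th root of unity `ω`, `(ω - 1)^(p-1)` is associated to `p`, so the bound on
  -- `I_∞` is exactly divisibility by `ω - 1`.
  obtain ⟨q, hq⟩ : z ^ p ^ (N + 1) - 1 ∣ Subalgebra.inclusion adjoinMuPInfty_le_integers s := by
    apply dvd_of_norm_le
    have h1 := norm_le_of_dvd (associated_sub_one_pow hω).dvd
    rw [pow_zero, one_mul, Subalgebra.coe_pow, norm_pow] at h1
    refine le_of_pow_le_pow_left₀ (n := p - 1) ?_ (norm_nonneg _)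
      ((norm_pow_le_of_mem_IInfty hs).trans h1)
    have := hp.out.two_le
    omega
  refine not_exists_pow_eq_one_sub hp2 not_isUnit_natCast_prime hz g q ?_
  have hxg : aeval (z - 1) g = Subalgebra.inclusion adjoinMuPInfty_le_integers x := by
    apply Subtype.ext
    rw [← Subalgebra.coe_val, ← aeval_algHom_apply]
    simpa using hg
  rw [hxg, ← hq]
  have := congrArg (Subalgebra.inclusion (adjoinMuPInfty_le_integers (p := p))) hsx
  simp only [map_sub, map_mul, map_pow, map_natCast, map_one] at this
  linear_combination -this

end Integers

/-! ### The congruence for `p = 2` in `ℤ_2[μ_{2^∞}]` -/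

section IntegersTwo

open Polynomial

theorem not_exists_sq_eq_one_add_two_mul {x : PadicAlgCl 2}
    (hx : x ∈ adjoinMuPInfty 2 ℤ_[2] (AlgebraicClosure ℚ_[2])) {η : PadicAlgCl 2}
    (hη : η ^ 4 = -1) (q : padicAlgClIntegers 2) (h : x ^ 2 = 1 + 2 * η + 4 * q) : False := by
  obtain ⟨N, hN⟩ := exists_forall_mem_adjoin hx
  -- Taking `ζ` as a root of the given `η` makes `η = ζ^(2^(N+1))` hold exactly, with `ζ` of order
  -- `2^(N+4)`.
  obtain ⟨ζ, hζη⟩ := IsAlgClosed.exists_pow_nat_eq η (n := 2 ^ (N + 1)) (by positivity)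
  have h1 : ζ ^ 2 ^ (N + 3) = -1 := by
    rw [show 2 ^ (N + 3) = 2 ^ (N + 1) * 4 by ring, pow_mul, hζη, hη]
  have hζ : IsPrimitiveRoot ζ (2 ^ (N + 4)) := by
    have : orderOf ζ = 2 ^ (N + 3 + 1) := by
      refine orderOf_eq_prime_pow ?_ ?_
      · rw [h1]
        norm_num
      · rw [pow_succ, pow_mul, h1]
        norm_num
    exact this ▸ IsPrimitiveRoot.orderOf ζ
  obtain ⟨g, hg⟩ := exists_aeval_sub_one_eq (hN (N + 4) (by omega) ζ hζ)
  obtain ⟨z, rfl, hz⟩ := exists_integers_isPrimitiveRoot hζ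
  refine not_exists_sq_eq_one_add ?_ hz g q ?_
  · exact_mod_cast not_isUnit_natCast_prime (p := 2)
  · apply Subtype.val_injective
    have hxg : ((aeval (z - 1) g : padicAlgClIntegers 2) : PadicAlgCl 2) = x := by
      rw [← Subalgebra.coe_val, ← aeval_algHom_apply]
      simpa using hg
    rw [← Subalgebra.coe_val] at hxg ⊢
    simp only [map_pow, map_add, map_mul, map_one, map_ofNat, hxg]
    rw [h, ← hζη]
    rfl

theorem not_exists_sq_sub_mem (i ζ : ZpMuPInfty 2) (hi : i ^ 2 = -1) (hζ : ζ ^ 4 = -1) :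
    ¬ ∃ x : ZpMuPInfty 2, x ^ 2 - (i + 2 * ζ) ∈ pIInfty 2 (ZpMuPInfty 2) := by
  rintro ⟨x, hx⟩
  obtain ⟨s, hs, hsx⟩ := mem_pIInfty.mp hx
  obtain ⟨q, hq⟩ : ((2 : ℕ) : padicAlgClIntegers 2) ∣
      Subalgebra.inclusion (adjoinMuPInfty_le_integers (p := 2)) s := by
    apply dvd_of_norm_le
    have := norm_pow_le_of_mem_IInfty hs
    rw [show 2 - 1 = 1 from rfl, pow_one] at this
    exact this
  obtain ⟨ω, hω⟩ := IsAlgClosed.exists_pow_nat_eq (i : PadicAlgCl 2) two_pos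
  have hi' : (i : PadicAlgCl 2) ^ 2 = -1 := by
    simpa using congrArg (adjoinMuPInfty 2 ℤ_[2] (AlgebraicClosure ℚ_[2])).val hi
  have hζ' : (ζ : PadicAlgCl 2) ^ 4 = -1 := by
    simpa using congrArg (adjoinMuPInfty 2 ℤ_[2] (AlgebraicClosure ℚ_[2])).val hζ
  have hq' : (s : PadicAlgCl 2) = 2 * q := by
    have := congrArg (padicAlgClIntegers 2).val hq
    rw [map_mul, map_natCast, Nat.cast_ofNat] at this
    exact this
  have hsx' : 2 * (s : PadicAlgCl 2) = x ^ 2 - (i + 2 * ζ) := by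
    have := congrArg (adjoinMuPInfty 2 ℤ_[2] (AlgebraicClosure ℚ_[2])).val hsx
    simpa only [map_mul, map_sub, map_add, map_pow, map_natCast, map_ofNat, Nat.cast_ofNat,
      Subalgebra.coe_val] using this
  have hω4 : ω ^ 4 = -1 := by rw [show ω ^ 4 = (ω ^ 2) ^ 2 by ring, hω, hi']
  have hω8 : ω ^ 2 ^ 3 = 1 := by
    rw [show ω ^ 2 ^ 3 = (ω ^ 4) ^ 2 by ring, hω4]
    norm_num
  have hωint : ‖ω‖ ≤ 1 := norm_le_one_of_pow_eq_one (by norm_num) hω8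
  -- Since `ω^2 = i` and `ω^7 = ω⁻¹`, this divides the equation by `i`, turning `i + 2ζ` into `1 +
  -- 2ζω^6`.
  refine not_exists_sq_eq_one_add_two_mul (x := x * ω ^ 7) (η := ζ * ω ^ 6)
    (mul_mem x.2 (pow_mem (mem_adjoinMuPInfty hω8) 7)) ?_ (q * ⟨ω, hωint⟩ ^ 6) ?_
  · rw [mul_pow, hζ', ← pow_mul, show ω ^ (6 * 4) = (ω ^ 4) ^ 6 by ring, hω4]
    norm_num
  · have h8 : ω ^ 8 = 1 := hω8
    have e : ((q * ⟨ω, hωint⟩ ^ 6 : padicAlgClIntegers 2) : PadicAlgCl 2) = q * ω ^ 6 := by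
      simp
    rw [e]
    have e2 : (x : PadicAlgCl 2) ^ 2 = ω ^ 2 + 2 * ζ + 4 * q := by
      rw [hω]
      linear_combination -hsx' + 2 * hq'
    rw [mul_pow, e2]
    linear_combination (ω ^ 8 + 1 + (2 * ζ + 4 * q) * ω ^ 6) * h8

end IntegersTwo

/-! ### Divisibility by powers of `p` in `ℤ_p[μ_{p^∞}]` -/

section Divisibility

open Polynomial

variable {p : ℕ} [hp : Fact p.Prime]

/-- Write `x = g(z - 1)`. Divisibility in the larger ring shows that `g` is `X^m k + p r`, where `(z
- 1)^m` is associated to `p` already in `ℤ_p[μ_{p^∞}]`. So norms detect divisibility by `p` there.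
-/
theorem prime_dvd_of_dvd_inclusion {x : ZpMuPInfty p}
    (h : (p : padicAlgClIntegers p) ∣ Subalgebra.inclusion adjoinMuPInfty_le_integers x) :
    (p : ZpMuPInfty p) ∣ x := by
  obtain ⟨N, hN⟩ := exists_forall_mem_adjoin x.2
  obtain ⟨z, hz⟩ := exists_isPrimitiveRoot_adjoinMuPInfty (p := p) (A := ℤ_[p])
    (K := AlgebraicClosure ℚ_[p]) (N + 1)
  have hζ : IsPrimitiveRoot (z : PadicAlgCl p) (p ^ (N + 1)) :=
    hz.map_of_injective (f := (adjoinMuPInfty p ℤ_[p] (AlgebraicClosure ℚ_[p])).val)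
      Subtype.val_injective
  obtain ⟨g, hg⟩ := exists_aeval_sub_one_eq (hN (N + 1) (by omega) _ hζ)
  have hxg : x = aeval (z - 1) g := by
    apply Subtype.val_injective
    rw [← Subalgebra.coe_val, ← aeval_algHom_apply]
    simpa using hg.symm
  set f := Subalgebra.inclusion (adjoinMuPInfty_le_integers (p := p)) with hf
  have hfz : IsPrimitiveRoot (f z) (p ^ (N + 1)) :=
    hz.map_of_injective (Subalgebra.inclusion_injective _)
  have hass := associated_sub_one_pow hfz
  rw [hxg, ← aeval_algHom_apply, map_sub, map_one] at h
  obtain ⟨k, r, rfl⟩ := exists_eq_X_pow_mul_add (X_pow_dvd_map_of_pow_dvd_aeval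
    (not_isUnit_sub_one_of_isPrimitiveRoot not_isUnit_natCast_prime hfz)
    (sub_one_ne_zero_of_isPrimitiveRoot hfz) hass.dvd le_rfl g (hass.dvd.trans h))
  rw [hxg]
  simp only [map_add, map_mul, map_pow, aeval_X, map_natCast]
  exact dvd_add ((associated_sub_one_pow hz).symm.dvd.mul_right _) (dvd_mul_right _ _)

theorem prime_pow_dvd_of_norm_le {x : ZpMuPInfty p} {k : ℕ}
    (h : ‖(x : PadicAlgCl p)‖ ≤ ‖(p : PadicAlgCl p)‖ ^ k) : (p : ZpMuPInfty p) ^ k ∣ x := by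
  induction k generalizing x with
  | zero => simp
  | succ k ih =>
    have hp0 := norm_natCast_prime_pos (p := p)
    have h1 : (p : padicAlgClIntegers p) ∣ Subalgebra.inclusion adjoinMuPInfty_le_integers x := by
      apply dvd_of_norm_le
      refine h.trans ?_
      rw [pow_succ]
      exact mul_le_of_le_one_left hp0.le (pow_le_one₀ hp0.le norm_natCast_prime_lt_one.le)
    obtain ⟨y, rfl⟩ := prime_dvd_of_dvd_inclusion h1
    have h2 : ‖((p * y : ZpMuPInfty p) : PadicAlgCl p)‖ =
        ‖(p : PadicAlgCl p)‖ * ‖(y : PadicAlgCl p)‖ := by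
      rw [← norm_mul]
      rfl
    rw [h2, pow_succ'] at h
    rw [pow_succ']
    exact mul_dvd_mul_left _ (ih (le_of_mul_le_mul_left h hp0))

theorem norm_le_of_prime_pow_dvd {x : ZpMuPInfty p} {k : ℕ} (h : (p : ZpMuPInfty p) ^ k ∣ x) :
    ‖(x : PadicAlgCl p)‖ ≤ ‖(p : PadicAlgCl p)‖ ^ k := by
  have h1 := map_dvd (Subalgebra.inclusion (adjoinMuPInfty_le_integers (p := p))) h
  have h2 := norm_le_of_dvd h1
  rw [map_pow, map_natCast, Subalgebra.coe_pow, norm_pow] at h2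
  exact h2

/-- `p`-adically, `ℤ_p[μ_{p^∞}]` has no zero divisors. -/
theorem prime_pow_dvd_or_dvd {x y : ZpMuPInfty p} {k : ℕ}
    (h : (p : ZpMuPInfty p) ^ (k + k) ∣ x * y) :
    (p : ZpMuPInfty p) ^ k ∣ x ∨ (p : ZpMuPInfty p) ^ k ∣ y := by
  by_contra hc
  rw [not_or] at hc
  have hx := lt_of_not_ge (fun h => hc.1 (prime_pow_dvd_of_norm_le h))
  have hy := lt_of_not_ge (fun h => hc.2 (prime_pow_dvd_of_norm_le h))
  have h1 := norm_le_of_prime_pow_dvd h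
  rw [Subalgebra.coe_mul, norm_mul, pow_add] at h1
  exact absurd (mul_lt_mul'' hx hy (by positivity) (by positivity)) (not_lt.mpr h1)

end Divisibility

/-! ### Completion with respect to a principal ideal -/

section Completion

variable {A : Type*} [CommRing A] (c : A)

theorem exists_eq_algebraMap_add_pow_mul (k : ℕ) (b : AdicCompletion (Ideal.span {c}) A) :
    ∃ a b', b = algebraMap A _ a + algebraMap A _ c ^ k * b' := by
  obtain ⟨a, ha⟩ := Ideal.Quotient.mk_surjective (AdicCompletion.evalₐ (Ideal.span {c}) k b)
  have hker : b - algebraMap A _ a ∈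
      (Ideal.span {c} ^ k • ⊤ : Submodule A (AdicCompletion (Ideal.span {c}) A)) := by
    rw [AdicCompletion.pow_smul_top_eq_ker_eval (Submodule.fg_span_singleton c),
      LinearMap.mem_ker, ← AdicCompletion.factor_evalₐ_eq_eval _ _ (by simp), map_sub,
      AlgHom.commutes, ← ha, Ideal.Quotient.algebraMap_eq, sub_self, map_zero]
  rw [Ideal.span_singleton_pow, Submodule.ideal_span_singleton_smul,
    Submodule.mem_smul_pointwise_iff_exists] at hker
  obtain ⟨b', _, hb'⟩ := hker
  refine ⟨a, b', ?_⟩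
  rw [← map_pow, ← Algebra.smul_def, hb']
  ring

theorem pow_dvd_of_algebraMap_eq {k : ℕ} {a : A} {b : AdicCompletion (Ideal.span {c}) A}
    (h : algebraMap A _ a = algebraMap A _ c ^ k * b) : c ^ k ∣ a := by
  have h1 := congrArg (AdicCompletion.evalₐ (Ideal.span {c}) k) h
  rw [map_mul, map_pow, AlgHom.commutes, AlgHom.commutes, ← map_pow,
    Ideal.Quotient.algebraMap_eq, Ideal.Quotient.eq_zero_iff_mem.mpr
      (Ideal.pow_mem_pow (Ideal.mem_span_singleton_self c) k), zero_mul,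
    Ideal.Quotient.eq_zero_iff_mem, Ideal.span_singleton_pow, Ideal.mem_span_singleton] at h1
  exact h1

theorem eq_zero_of_forall_pow_dvd {b : AdicCompletion (Ideal.span {c}) A}
    (h : ∀ k, algebraMap A _ c ^ k ∣ b) : b = 0 := by
  refine AdicCompletion.ext_evalₐ fun n => ?_
  obtain ⟨b', rfl⟩ := h n
  rw [map_mul, map_pow, AlgHom.commutes, ← map_pow,
    Ideal.Quotient.algebraMap_eq, Ideal.Quotient.eq_zero_iff_mem.mpr
      (Ideal.pow_mem_pow (Ideal.mem_span_singleton_self c) n), zero_mul, map_zero]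

theorem eq_zero_of_algebraMap_mul_eq_zero [IsDomain A] (hc : c ≠ 0)
    {b : AdicCompletion (Ideal.span {c}) A} (h : algebraMap A _ c * b = 0) : b = 0 := by
  refine eq_zero_of_forall_pow_dvd c fun n => ?_
  obtain ⟨a, b', rfl⟩ := exists_eq_algebraMap_add_pow_mul c n b
  have h1 := pow_dvd_of_algebraMap_eq c (k := n + 1) (a := c * a) (b := -b') (by
    rw [map_mul]
    linear_combination h)
  rw [pow_succ', mul_dvd_mul_iff_left hc] at h1
  refine dvd_add ?_ (dvd_mul_right _ _)
  rw [← map_pow]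
  exact map_dvd _ h1

theorem exists_eq_algebraMap_add_of_ne_zero {b : AdicCompletion (Ideal.span {c}) A} (hb : b ≠ 0) :
    ∃ k, ∀ m a b', k ≤ m → b = algebraMap A _ a + algebraMap A _ c ^ m * b' → ¬ c ^ k ∣ a := by
  by_contra! hcon
  refine hb (eq_zero_of_forall_pow_dvd c fun k => ?_)
  obtain ⟨m, a, b', hkm, rfl, hdvd⟩ := hcon k
  refine dvd_add ?_ ((pow_dvd_pow _ hkm).mul_right _)
  rw [← map_pow]
  exact map_dvd _ hdvd

/-- Take `m` beyond the levels at which `a` and `b` are seen to be nonzero. Approximants modulo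
`c^(2m)` have product divisible by `c^(2m)`, so one of them is divisible by `c^m`, a contradiction.
-/
theorem mul_ne_zero_of_pow_dvd_or_dvd
    (hA : ∀ (x y : A) (k : ℕ), c ^ (k + k) ∣ x * y → c ^ k ∣ x ∨ c ^ k ∣ y)
    {a b : AdicCompletion (Ideal.span {c}) A} (ha : a ≠ 0) (hb : b ≠ 0) : a * b ≠ 0 := by
  intro hab
  obtain ⟨k, hk⟩ := exists_eq_algebraMap_add_of_ne_zero c ha
  obtain ⟨l, hl⟩ := exists_eq_algebraMap_add_of_ne_zero c hb
  obtain ⟨a₀, a₁, h1⟩ := exists_eq_algebraMap_add_pow_mul c (max k l + max k l) a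
  obtain ⟨b₀, b₁, h2⟩ := exists_eq_algebraMap_add_pow_mul c (max k l + max k l) b
  have hka := hk _ _ _ (by omega) h1
  have hlb := hl _ _ _ (by omega) h2
  have h3 := pow_dvd_of_algebraMap_eq c (k := max k l + max k l) (a := a₀ * b₀)
    (b := -(a₁ * b + algebraMap A _ a₀ * b₁)) (by
      rw [map_mul]
      linear_combination hab - h1 * b - algebraMap A _ a₀ * h2)
  rcases hA _ _ _ h3 with h | h
  · exact hka ((pow_dvd_pow c (le_max_left k l)).trans h)
  · exact hlb ((pow_dvd_pow c (le_max_right k l)).trans h)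

end Completion

/-! ### The `p`-adic completion of `ℤ_p[μ_{p^∞}]` -/

section ZpCompletion

variable {p : ℕ} [hp : Fact p.Prime]

theorem natCast_prime_ne_zero_ZpMuPInfty : (p : ZpMuPInfty p) ≠ 0 :=
  Nat.cast_ne_zero.mpr hp.out.ne_zero

variable (p) in
/-- The map from `ℤ_p[μ_{p^∞}]` to its completion. -/
noncomputable def toZpMuPInftyCompletion : ZpMuPInfty p →+* ZpMuPInftyCompletion p :=
  algebraMap (ZpMuPInfty p) (ZpMuPInftyCompletion p)

theorem exists_eq_toZpMuPInftyCompletion_add (b : ZpMuPInftyCompletion p) :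
    ∃ a b', b = toZpMuPInftyCompletion p a + p * b' := by
  obtain ⟨a, b', h⟩ := exists_eq_algebraMap_add_pow_mul (p : ZpMuPInfty p) 1 b
  refine ⟨a, b', ?_⟩
  rw [pow_one, map_natCast] at h
  exact h

theorem eq_zero_of_prime_mul_eq_zero (b : ZpMuPInftyCompletion p) (h : p * b = 0) : b = 0 := by
  refine eq_zero_of_algebraMap_mul_eq_zero (p : ZpMuPInfty p) natCast_prime_ne_zero_ZpMuPInfty ?_
  rw [map_natCast]
  exact h

theorem exists_eq_prime_mul_of_toZpMuPInftyCompletion (a : ZpMuPInfty p)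
    (b : ZpMuPInftyCompletion p) (h : toZpMuPInftyCompletion p a = p * b) : ∃ a', a = p * a' := by
  have := pow_dvd_of_algebraMap_eq (p : ZpMuPInfty p) (k := 1) (a := a) (b := b) (by
    rw [pow_one, map_natCast]
    exact h)
  rwa [pow_one] at this

theorem toZpMuPInftyCompletion_injective : Function.Injective (toZpMuPInftyCompletion p) := by
  rw [injective_iff_map_eq_zero]
  intro a ha
  by_contra h0
  have hpos : 0 < ‖(a : PadicAlgCl p)‖ := norm_pos_iff.mpr fun h => h0 (Subtype.ext h)
  obtain ⟨n, hn⟩ := exists_pow_lt_of_lt_one hpos (norm_natCast_prime_lt_one (p := p))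
  have h1 := pow_dvd_of_algebraMap_eq (p : ZpMuPInfty p) (k := n) (a := a) (b := 0) (by
    rw [mul_zero]
    exact ha)
  exact absurd (norm_le_of_prime_pow_dvd h1) (not_le.mpr hn)

instance : NoZeroDivisors (ZpMuPInftyCompletion p) where
  eq_zero_or_eq_zero_of_mul_eq_zero {a b} h := by
    by_contra hc
    rw [not_or] at hc
    exact mul_ne_zero_of_pow_dvd_or_dvd (p : ZpMuPInfty p)
      (fun _ _ _ => prime_pow_dvd_or_dvd) hc.1 hc.2 h

instance : Nontrivial (ZpMuPInftyCompletion p) :=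
  toZpMuPInftyCompletion_injective.nontrivial

instance : IsDomain (ZpMuPInftyCompletion p) := NoZeroDivisors.to_isDomain _

/-- The completion is a domain, so it has no `p^n`-th roots of unity beyond the powers of a
primitive one from `ℤ_p[μ_{p^∞}]`. This lets the given `i` and `ζ` descend when `p = 2`. -/
theorem exists_toZpMuPInftyCompletion_eq {x : ZpMuPInftyCompletion p} {n : ℕ}
    (hx : x ^ p ^ n = 1) : ∃ y : ZpMuPInfty p, toZpMuPInftyCompletion p y = x := by
  obtain ⟨ζ, hζ⟩ := exists_isPrimitiveRoot_adjoinMuPInfty (p := p) (A := ℤ_[p])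
    (K := AlgebraicClosure ℚ_[p]) n
  have : NeZero (p ^ n) := ⟨pow_ne_zero _ hp.out.ne_zero⟩
  obtain ⟨i, _, rfl⟩ :=
    (hζ.map_of_injective toZpMuPInftyCompletion_injective).eq_pow_of_pow_eq_one hx
  exact ⟨ζ ^ i, map_pow _ _ _⟩

theorem frobeniusSurjectiveFiniteLevels_ZpMuPInftyCompletion :
    FrobeniusSurjectiveFiniteLevels p (ZpMuPInftyCompletion p) := by
  refine frobeniusSurjectiveFiniteLevels_of
    (fun n => exists_frobenius_eq_iterate_verschiebung_one_map (toZpMuPInftyCompletion p) n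
      (exists_frobenius_eq_iterate_verschiebung_one exists_isPrimitiveRoot_adjoinMuPInfty n))
    fun r => ?_
  obtain ⟨a, b, rfl⟩ := exists_eq_toZpMuPInftyCompletion_add r
  obtain ⟨s, t, rfl⟩ := exists_eq_pow_add_adjoinMuPInfty padicInt_exists_eq_pow_add a
  refine ⟨toZpMuPInftyCompletion p s, toZpMuPInftyCompletion p t + b, ?_⟩
  rw [map_add, map_mul, map_pow, map_natCast]
  ring

theorem exists_pow_sub_mem_of_completion (c : ZpMuPInfty p)
    (h : ∃ x : ZpMuPInftyCompletion p,
      x ^ p - toZpMuPInftyCompletion p c ∈ pIInfty p (ZpMuPInftyCompletion p)) :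
    ∃ x : ZpMuPInfty p, x ^ p - c ∈ pIInfty p (ZpMuPInfty p) :=
  exists_pow_sub_mem_of_map (toZpMuPInftyCompletion p) eq_zero_of_prime_mul_eq_zero
    exists_eq_toZpMuPInftyCompletion_add exists_eq_prime_mul_of_toZpMuPInftyCompletion c h

end ZpCompletion

/-! ### The map from `ℤ[μ_{p^∞}]` to `ℤ_p[μ_{p^∞}]` -/

section ZMu

variable (p : ℕ) [hp : Fact p.Prime]

/-- `ℤ[μ_{p^∞}]` is integral over `ℤ`, so it maps to the algebraic closure of `ℚ_p`, and roots of
unity go to roots of unity. -/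
theorem nonempty_ringHom_ZMuPInfty_ZpMuPInfty : Nonempty (ZMuPInfty p →+* ZpMuPInfty p) := by
  have : Algebra.IsIntegral ℤ (ZMuPInfty p) := Algebra.IsIntegral.adjoin (by
    rintro x ⟨n, hn⟩
    exact IsIntegral.of_pow (pow_pos hp.out.pos n) (by rw [hn]; exact isIntegral_one))
  let f : ZMuPInfty p →ₐ[ℤ] AlgebraicClosure ℚ_[p] := IsAlgClosed.lift
  refine ⟨(f : ZMuPInfty p →+* AlgebraicClosure ℚ_[p]).codRestrict
    (adjoinMuPInfty p ℤ_[p] (AlgebraicClosure ℚ_[p])) ?_⟩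
  rintro ⟨x, hx⟩
  induction hx using Algebra.adjoin_induction with
  | mem x hx =>
    obtain ⟨n, hn⟩ := hx
    refine mem_adjoinMuPInfty (n := n) ?_
    have h1 : (⟨x, mem_adjoinMuPInfty hn⟩ : ZMuPInfty p) ^ p ^ n = 1 := Subtype.ext hn
    rw [← map_pow, h1, map_one]
  | algebraMap a =>
    have : f (algebraMap ℤ _ a) = algebraMap ℤ _ a := f.commutes a
    change f (algebraMap ℤ _ a) ∈ _
    rw [this, eq_intCast]
    exact intCast_mem _ a
  | add x y hx hy h1 h2 =>
    have := add_mem h1 h2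
    rwa [← map_add] at this
  | mul x y hx hy h1 h2 =>
    have := mul_mem h1 h2
    rwa [← map_mul] at this

end ZMu

/-! ### Conclusion -/

section Conclusion

variable {p : ℕ} [hp : Fact p.Prime]

theorem pow_four_eq_neg_one {R : Type*} [CommRing R] [IsDomain R] {ζ : R}
    (h : IsPrimitiveRoot ζ 8) : ζ ^ 4 = -1 :=
  (h.pow (by norm_num) (by norm_num : 8 = 4 * 2)).eq_neg_one_of_two_right

theorem sq_eq_neg_one {R : Type*} [CommRing R] [IsDomain R] {i : R}
    (h : IsPrimitiveRoot i 4) : i ^ 2 = -1 :=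
  (h.pow (by norm_num) (by norm_num : 4 = 2 * 2)).eq_neg_one_of_two_right

/-- A single `r` that is not a `p`-th power modulo `p I_∞` refutes both surjectivity claims; for `p
= 2` it is built from an eighth root of unity, whence the exponent `3`. -/
theorem conclusion_of {R : Type*} [CommRing R] (hF : FrobeniusSurjectiveFiniteLevels p R)
    (hodd : p ≠ 2 → ¬ ∃ x : R, x ^ p - (1 - (p : R)) ∈ pIInfty p R)
    (htwo : p = 2 → ∀ i ζ : R, IsPrimitiveRoot i 4 → IsPrimitiveRoot ζ 8 →
      ¬ ∃ x : R, x ^ 2 - (i + 2 * ζ) ∈ pIInfty p R)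
    (hζ : ∃ ζ : R, IsPrimitiveRoot ζ (p ^ 3)) :
    FrobeniusSurjectiveFiniteLevels p R ∧ ¬ TeichmullerInFrobeniusImage p R ∧
      ¬ PthPowerSurjectiveModPIInfty p R ∧
      (p ≠ 2 → ¬ ∃ x : R, x ^ p - (1 - (p : R)) ∈ pIInfty p R) ∧
      (p = 2 → ∀ i ζ : R, IsPrimitiveRoot i 4 → IsPrimitiveRoot ζ 8 →
        ¬ ∃ x : R, x ^ 2 - (i + 2 * ζ) ∈ pIInfty p R) := by
  have hne : ∃ r : R, ¬ ∃ x : R, x ^ p - r ∈ pIInfty p R := by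
    by_cases hp2 : p = 2
    · subst hp2
      obtain ⟨ζ, hζ⟩ := hζ
      exact ⟨_, htwo rfl (ζ ^ 2) ζ (hζ.pow (by norm_num) (by norm_num)) hζ⟩
    · exact ⟨_, hodd hp2⟩
  obtain ⟨r, hr⟩ := hne
  exact ⟨hF, fun h => hr (exists_pow_sub_mem_of_teichmullerInFrobeniusImage h r),
    fun h => hr (exists_pow_sub_mem_of_pthPowerSurjective h r), hodd, htwo⟩

end Conclusion

theorem mainTheorem8 (p : ℕ) [hp : Fact p.Prime] :
    -- the ring `ℤ[μ_{p^∞}]`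
    (FrobeniusSurjectiveFiniteLevels p (ZMuPInfty p) ∧
      ¬ TeichmullerInFrobeniusImage p (ZMuPInfty p) ∧
      ¬ PthPowerSurjectiveModPIInfty p (ZMuPInfty p) ∧
      (p ≠ 2 → ¬ ∃ x : ZMuPInfty p,
        x ^ p - (1 - (p : ZMuPInfty p)) ∈ pIInfty p (ZMuPInfty p)) ∧
      (p = 2 → ∀ i ζ : ZMuPInfty p, IsPrimitiveRoot i 4 → IsPrimitiveRoot ζ 8 →
        ¬ ∃ x : ZMuPInfty p, x ^ 2 - (i + 2 * ζ) ∈ pIInfty p (ZMuPInfty p))) ∧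
    -- the ring `ℤ_p[μ_{p^∞}]`
    (FrobeniusSurjectiveFiniteLevels p (ZpMuPInfty p) ∧
      ¬ TeichmullerInFrobeniusImage p (ZpMuPInfty p) ∧
      ¬ PthPowerSurjectiveModPIInfty p (ZpMuPInfty p) ∧
      (p ≠ 2 → ¬ ∃ x : ZpMuPInfty p,
        x ^ p - (1 - (p : ZpMuPInfty p)) ∈ pIInfty p (ZpMuPInfty p)) ∧
      (p = 2 → ∀ i ζ : ZpMuPInfty p, IsPrimitiveRoot i 4 → IsPrimitiveRoot ζ 8 →
        ¬ ∃ x : ZpMuPInfty p, x ^ 2 - (i + 2 * ζ) ∈ pIInfty p (ZpMuPInfty p))) ∧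
    -- the `p`-adic completion of `ℤ_p[μ_{p^∞}]`
    (FrobeniusSurjectiveFiniteLevels p (ZpMuPInftyCompletion p) ∧
      ¬ TeichmullerInFrobeniusImage p (ZpMuPInftyCompletion p) ∧
      ¬ PthPowerSurjectiveModPIInfty p (ZpMuPInftyCompletion p) ∧
      (p ≠ 2 → ¬ ∃ x : ZpMuPInftyCompletion p,
        x ^ p - (1 - (p : ZpMuPInftyCompletion p)) ∈ pIInfty p (ZpMuPInftyCompletion p)) ∧
      (p = 2 → ∀ i ζ : ZpMuPInftyCompletion p, IsPrimitiveRoot i 4 → IsPrimitiveRoot ζ 8 →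
        ¬ ∃ x : ZpMuPInftyCompletion p,
          x ^ 2 - (i + 2 * ζ) ∈ pIInfty p (ZpMuPInftyCompletion p))) := by
  refine ⟨conclusion_of ?_ ?_ ?_ (exists_isPrimitiveRoot_adjoinMuPInfty 3),
    conclusion_of ?_ ?_ ?_ (exists_isPrimitiveRoot_adjoinMuPInfty 3),
    conclusion_of ?_ ?_ ?_ ?_⟩
  · exact frobeniusSurjectiveFiniteLevels_adjoinMuPInfty int_exists_eq_pow_add
  · rintro hp2 ⟨x, hx⟩
    obtain ⟨f⟩ := nonempty_ringHom_ZMuPInfty_ZpMuPInfty p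
    refine not_exists_pow_sub_mem_of_ne_two hp2 ⟨f x, ?_⟩
    have := map_mem_pIInfty f hx
    simpa only [map_sub, map_pow, map_one, map_natCast] using this
  · rintro rfl i ζ hi hζ ⟨x, hx⟩
    obtain ⟨f⟩ := nonempty_ringHom_ZMuPInfty_ZpMuPInfty 2
    refine not_exists_sq_sub_mem (f i) (f ζ) ?_ ?_ ⟨f x, ?_⟩
    · rw [← map_pow, sq_eq_neg_one hi, map_neg, map_one]
    · rw [← map_pow, pow_four_eq_neg_one hζ, map_neg, map_one]
    · have := map_mem_pIInfty f hx
      simpa only [map_sub, map_add, map_mul, map_pow, map_ofNat] using this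
  · exact frobeniusSurjectiveFiniteLevels_adjoinMuPInfty padicInt_exists_eq_pow_add
  · exact not_exists_pow_sub_mem_of_ne_two
  · rintro rfl i ζ hi hζ
    exact not_exists_sq_sub_mem i ζ (sq_eq_neg_one hi) (pow_four_eq_neg_one hζ)
  · exact frobeniusSurjectiveFiniteLevels_ZpMuPInftyCompletion
  · rintro hp2 ⟨x, hx⟩
    refine not_exists_pow_sub_mem_of_ne_two hp2 (exists_pow_sub_mem_of_completion _ ⟨x, ?_⟩)
    rwa [map_sub, map_one, map_natCast]
  · rintro rfl i ζ hi hζ ⟨x, hx⟩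
    obtain ⟨i, rfl⟩ := exists_toZpMuPInftyCompletion_eq (p := 2) (n := 2) hi.pow_eq_one
    obtain ⟨ζ, rfl⟩ := exists_toZpMuPInftyCompletion_eq (p := 2) (n := 3) hζ.pow_eq_one
    have hinj := toZpMuPInftyCompletion_injective (p := 2)
    refine not_exists_sq_sub_mem i ζ (sq_eq_neg_one (hi.of_map_of_injective hinj))
      (pow_four_eq_neg_one (hζ.of_map_of_injective hinj))
      (exists_pow_sub_mem_of_completion (p := 2) _ ⟨x, ?_⟩)
    rwa [map_add, map_mul, map_ofNat]
  · obtain ⟨ζ, hζ⟩ := exists_isPrimitiveRoot_adjoinMuPInfty (p := p) (A := ℤ_[p])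
      (K := AlgebraicClosure ℚ_[p]) 3
    exact ⟨_, hζ.map_of_injective toZpMuPInftyCompletion_injective⟩
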